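/- For $n\ge 1$ points $x_1,\dots,x_n$ of a metric space let $E^0_\alpha(x_1,\dots,x_n)=\sum_{e\in T}|e|^\alpha$, where $T$ is a minimum spanning tree on $x_1,\dots,x_n$ and $|e|$ is the length of the edge $e$. A probability measure $\mu$ on a metric space is $d$-Ahlfors regular if there are $C,\delta_0>0$ with $\frac1C\delta^d\le\mu(B_\delta(x))\le C\delta^d$ for all $x\in\operatorname{supp}\mu$ and $0<\delta<\delta_0$, where $B_\delta(x)$ is the open ball. For a sequence $s=(s_k)_{k\ge0}$ with $s_k\in\{1,\frac57\}$ and $s_0=1$, let $S_0=\{[0,1]\}$, and let $S_{k+1}$ consist of the two end pieces of length $s_{k+1}3^{-(k+1)}$ of each of the $2^k$ intervals of $S_k$ (which have length $s_k3^{-k}$). Let $C_s=\bigcap_k\bigcup_{I\in S_k}I$, and let $\mu_s$ be the natural probability measure on $C_s$, which gives mass $2^{-k}$ to each interval of $S_k$, for all $k$. For $s\equiv1$ this is the middle-thirds Cantor set with its natural measure $\kappa$. Let $d=\log 2/\log 3$ and $0<\alpha<d$. There is a sequence $s$ as above that takes both values $1$ and $\frac57$ infinitely often, in blocks whose lengths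 tend to infinity, such that $\sigma=\mu_s$ is a $d$-Ahlfors regular measure with support $C_s\subseteq[0,1]$ and the following holds. If $x_1,x_2,\dots$ are i.i.d. samples from $\sigma$, then $n^{-(d-\alpha)/d}E^0_\alpha(x_1,\dots,x_n)$ does not converge in probability as $n\to\infty$. Moreover, there is a constant $c>0$ such that this quantity converges in probability to $c$ along one subsequence of $n$ and to $(5/7)^\alpha c$ along another. Here $c$ can be taken to be a limit in probability, along some subsequence of $n$, of $n^{-(d-\alpha)/d}E^0_\alpha(y_1,\dots,y_n)$ for i.i.d. samples $y_1,y_2,\dots$ from $\kappa$ (so $c$ is the limit of that quantity if it converges in probability). -/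

import Mathlib

open MeasureTheory ProbabilityTheory Filter Set
open scoped Topology

universe u

/-! ### Minimum spanning trees and their `α`-weight -/

/-- The length of the edge `{i, j}` of the complete graph on the points `x i`. -/
noncomputable def edgeLength {X : Type*} [MetricSpace X] {n : ℕ} (x : Fin n → X) :
    Sym2 (Fin n) → ℝ :=
  Sym2.lift ⟨fun i j => dist (x i) (x j), fun i j => dist_comm (x i) (x j)⟩

open Classical in
/-- The sum `∑_{e ∈ T} |e|^α` over the edges of a graph `T` on the points `x i`. -/
noncomputable def graphWeight {X : Type*} [MetricSpace X] {n : ℕ} (α : ℝ) (x : Fin n → X)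
    (T : SimpleGraph (Fin n)) : ℝ :=
  ∑ e ∈ T.edgeFinset, edgeLength x e ^ α

/-- `T` is a spanning tree on the points `x i` of minimal total length. -/
def IsMinSpanningTree {X : Type*} [MetricSpace X] {n : ℕ} (x : Fin n → X)
    (T : SimpleGraph (Fin n)) : Prop :=
  T.IsTree ∧ ∀ T' : SimpleGraph (Fin n), T'.IsTree → graphWeight 1 x T ≤ graphWeight 1 x T'

/-- `E⁰_α(x₁, …, xₙ)`, the `α`-weight of the minimum spanning tree. All minimum spanning trees
on the same points have the same multiset of edge lengths, so the infimum is taken over a set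
with a single value (for `n = 0` there is no tree, and the value is `0`). -/
noncomputable def mstWeight {X : Type*} [MetricSpace X] {n : ℕ} (α : ℝ) (x : Fin n → X) : ℝ :=
  sInf (graphWeight α x '' {T | IsMinSpanningTree x T})

/-- `n^{-(d-α)/d} E⁰_α(x₁, …, xₙ)`. -/
noncomputable def normalizedWeight {X : Type*} [MetricSpace X] (d α : ℝ) {n : ℕ}
    (x : Fin n → X) : ℝ :=
  (n : ℝ) ^ (-((d - α) / d)) * mstWeight α x

/-! ### Ahlfors regularity -/

/-- `d`-Ahlfors regularity of a measure, on its support. -/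
def IsAhlforsRegular {X : Type*} [MetricSpace X] [MeasurableSpace X] (d : ℝ)
    (μ : Measure X) : Prop :=
  ∃ c > 0, ∃ δ₀ > 0, ∀ x ∈ μ.support, ∀ δ : ℝ, 0 < δ → δ < δ₀ →
    1 / c * δ ^ d ≤ μ.real (Metric.ball x δ) ∧ μ.real (Metric.ball x δ) ≤ c * δ ^ d

/-! ### Random samples -/

/-- `x 0, x 1, …` are independent random variables on `(Ω, P)` with common distribution `μ`. -/
structure IsIIDSample {Ω : Type u} [MeasurableSpace Ω] (P : Measure Ω) (μ : Measure ℝ)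
    (x : ℕ → Ω → ℝ) : Prop where
  measurable : ∀ i, Measurable (x i)
  indep : iIndepFun x P
  law : ∀ i, P.map (x i) = μ

/-- The random variable `n^{-(d-α)/d} E⁰_α(x₁, …, xₙ)` of a sequence of samples. -/
noncomputable def sampleWeight {Ω : Type u} (d α : ℝ) (x : ℕ → Ω → ℝ) (n : ℕ) (ω : Ω) : ℝ :=
  normalizedWeight d α (fun i : Fin n => x i ω)

/-- For i.i.d. samples from `μ`, the normalized weights of the first `n k` samples converge to
the constant `c` in probability as `k → ∞`. -/
def WeightTendsto (d α : ℝ) (μ : Measure ℝ) (n : ℕ → ℕ) (c : ℝ) : Prop :=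
  ∀ (Ω : Type u) [MeasurableSpace Ω] (P : Measure Ω) [IsProbabilityMeasure P] (x : ℕ → Ω → ℝ),
    IsIIDSample P μ x →
      TendstoInMeasure P (fun k => sampleWeight d α x (n k)) atTop (fun _ => c)

/-- For i.i.d. samples from `μ`, the normalized weights of the first `n` samples do not converge
in probability as `n → ∞`, to any (possibly random) limit. -/
def WeightDiverges (d α : ℝ) (μ : Measure ℝ) : Prop :=
  ∀ (Ω : Type u) [MeasurableSpace Ω] (P : Measure Ω) [IsProbabilityMeasure P] (x : ℕ → Ω → ℝ),
    IsIIDSample P μ x →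
      ¬ ∃ Y : Ω → ℝ, TendstoInMeasure P (fun n => sampleWeight d α x n) atTop Y

/-! ### Modified Cantor sets

A sequence `s : ℕ → Bool` tells at which levels the construction is shrunk: level `k` consists of
`2^k` disjoint closed intervals of length `3^{-k}` if `s k = false`, and of length
`(5/7) 3^{-k}` if `s k = true`. Level `k + 1` keeps the two end pieces of the right length of every
interval of level `k`; the ratio of lengths is therefore `1/3` if `s (k+1) = s k`,
`(5/7)(1/3)` where `s` changes from `false` to `true`, and `(7/5)(1/3)` where it changes back. -/

/-- The length of the intervals of level `k`. -/
noncomputable def pieceLength (s : ℕ → Bool) (k : ℕ) : ℝ :=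
  (if s k then 5 / 7 else 1) * (1 / 3) ^ k

/-- The left end points of the intervals of level `k`, starting from `[0, pieceLength s 0]`. -/
noncomputable def leftEnds (s : ℕ → Bool) : ℕ → Set ℝ
  | 0 => {0}
  | k + 1 => leftEnds s k ∪
      (fun a => a + (pieceLength s k - pieceLength s (k + 1))) '' leftEnds s k

/-- The intervals of level `k`. -/
def pieces (s : ℕ → Bool) (k : ℕ) : Set (Set ℝ) :=
  (fun a => Icc a (a + pieceLength s k)) '' leftEnds s k

/-- The intersection over all levels of the union of the intervals of that level. -/
def modifiedCantorSet (s : ℕ → Bool) : Set ℝ :=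
  ⋂ k, ⋃₀ pieces s k

/-- The natural probability measure on the modified Cantor set: it gives equal mass to the `2^k`
intervals of level `k`, for every `k`. -/
structure IsNaturalMeasure (s : ℕ → Bool) (μ : Measure ℝ) : Prop where
  isProbabilityMeasure : IsProbabilityMeasure μ
  measure_piece : ∀ k, ∀ I ∈ pieces s k, μ I = (2⁻¹ : ENNReal) ^ k

/-- The sequence that is never shrunk, giving the middle-thirds Cantor set. -/
def cantorSeq : ℕ → Bool := fun _ => false

/-- `s` starts unshrunk, switches between the two states infinitely often, and the blocks of
consecutive levels in the same state become longer and longer. -/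
structure AlternatesAcrossScales (s : ℕ → Bool) : Prop where
  start : s 0 = false
  frequently_shrunk : ∃ᶠ k in atTop, s k = true
  frequently_unshrunk : ∃ᶠ k in atTop, s k = false
  long_blocks : ∀ R : ℕ, ∀ᶠ k in atTop, s k ≠ s (k + 1) →
    ∀ j ≤ R, s (k + 1 + j) = s (k + 1)

/-! Code the points of every $C_s$ by 0-1 addresses. The natural measure becomes fair coin tossing,
and the order of the points is the lexicographic order of addresses whatever `s` is
(`point_le_point_iff`). All the sets can thus be compared on one sample of addresses. On the line
the minimum spanning tree joins consecutive points (`mstWeight_eq_sum_succGap`), so the weight is a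
sum of $\alpha$-th powers of gaps.

Put $r=3^{-\alpha}$; then $\alpha<d$ says $2r>1$. Take $n=16^t=2^{4t}$ samples, for which typical
gaps have size $3^{-4t}$ and the normalizing factor is $(2r)^{-4t}$. Gaps between different cells of
level $3t$ contribute only $O((2r)^{3t})$ (`abs_gapSum_zero_sub_le`). Detail below level $5t$ moves
each gap by at most $2\cdot3^{-5t}$, in total $O(2^{4t}r^{5t})$ (`abs_gapSum_sub_le`). Both are
negligible after normalization. So only the levels from $3t$ to $5t$ matter: if `s` is constant
there, the normalized weight is that of the middle-thirds set, times $(5/7)^\alpha$ in the shrunk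
state (`abs_normalized_sub_le`).

Gaps inside cells of level $3t$ are small, so one sample has little influence. A bounded difference
inequality (`variance_pi_le_of_bounded_differences`) then gives concentration about `meanWeight`
(`measure_deviation_le`).

The means lie between two positive constants (`le_meanWeight`, `meanWeight_le`), so they converge to
some $c>0$ along a subsequence. Thin it to $\tau_0<\tau_1<\dots$ with disjoint windows
$[3\tau_b,5\tau_b]$, and let `s` be unshrunk on the even windows and shrunk on the odd ones.
`weightTendsto_of_constant` gives the limits $c$ and $(5/7)^\alpha c$, which differ. -/

namespace ModifiedCantor

/-! ### Coding of modified Cantor sets by binary sequences -/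

/-- The distance between the left end points of the two children of an interval of level `k`. -/
noncomputable def step (s : ℕ → Bool) (k : ℕ) : ℝ := pieceLength s k - pieceLength s (k + 1)

/-- The left end point of the interval of level `k` with address `ω 0, …, ω (k - 1)`. -/
noncomputable def leftEnd (s : ℕ → Bool) (ω : ℕ → Bool) (k : ℕ) : ℝ :=
  ∑ j ∈ Finset.range k, if ω j then step s j else 0

/-- The point of the modified Cantor set with address `ω`. -/
noncomputable def point (s : ℕ → Bool) (ω : ℕ → Bool) : ℝ :=
  ∑' j, if ω j then step s j else 0

/-- Two addresses agree on their first `m` letters. -/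
def Agree (m : ℕ) (ω ω' : ℕ → Bool) : Prop := ∀ j < m, ω j = ω' j

lemma Agree.symm {m : ℕ} {ω ω' : ℕ → Bool} (h : Agree m ω ω') : Agree m ω' ω :=
  fun j hj => (h j hj).symm

lemma Agree.trans {m : ℕ} {ω ω' ω'' : ℕ → Bool} (h : Agree m ω ω') (h' : Agree m ω' ω'') :
    Agree m ω ω'' :=
  fun j hj => (h j hj).trans (h' j hj)

lemma Agree.mono {m k : ℕ} (hmk : m ≤ k) {ω ω' : ℕ → Bool} (h : Agree k ω ω') : Agree m ω ω' :=
  fun j hj => h j (hj.trans_le hmk)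

lemma pieceLength_le (s : ℕ → Bool) (k : ℕ) : pieceLength s k ≤ (1 / 3) ^ k := by
  have : (0 : ℝ) < (1 / 3) ^ k := by positivity
  unfold pieceLength
  split_ifs <;> linarith

lemma le_pieceLength (s : ℕ → Bool) (k : ℕ) : 5 / 7 * (1 / 3) ^ k ≤ pieceLength s k := by
  have : (0 : ℝ) < (1 / 3) ^ k := by positivity
  unfold pieceLength
  split_ifs <;> linarith

lemma pieceLength_pos (s : ℕ → Bool) (k : ℕ) : 0 < pieceLength s k :=
  lt_of_lt_of_le (by positivity) (le_pieceLength s k)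

lemma step_nonneg (s : ℕ → Bool) (k : ℕ) : 0 ≤ step s k := by
  have h1 := le_pieceLength s k
  have h2 := pieceLength_le s (k + 1)
  have : (0 : ℝ) < (1 / 3) ^ k := by positivity
  rw [pow_succ] at h2
  unfold step
  linarith

lemma digit_nonneg (s ω : ℕ → Bool) (j : ℕ) : 0 ≤ (if ω j then step s j else 0 : ℝ) := by
  split_ifs
  · exact step_nonneg s j
  · exact le_rfl

lemma leftEnd_succ (s ω : ℕ → Bool) (k : ℕ) :
    leftEnd s ω (k + 1) = leftEnd s ω k + if ω k then step s k else 0 := by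
  simp [leftEnd, Finset.sum_range_succ]

lemma leftEnd_mono (s ω : ℕ → Bool) : Monotone (leftEnd s ω) :=
  monotone_nat_of_le_succ fun k => by
    rw [leftEnd_succ]
    linarith [digit_nonneg s ω k]

lemma rightEnd_antitone (s ω : ℕ → Bool) : Antitone fun k => leftEnd s ω k + pieceLength s k :=
  antitone_nat_of_succ_le fun k => by
    have : (if ω k then step s k else 0 : ℝ) ≤ step s k := by
      split_ifs
      · exact le_rfl
      · exact step_nonneg s k
    rw [leftEnd_succ]
    unfold step at *
    linarith

lemma leftEnd_le_add (s ω : ℕ → Bool) (k N : ℕ) :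
    leftEnd s ω N ≤ leftEnd s ω k + pieceLength s k := by
  rcases le_total k N with h | h
  · have := rightEnd_antitone s ω h
    have h' := (pieceLength_pos s N).le
    simp only at this
    linarith
  · linarith [leftEnd_mono s ω h, pieceLength_pos s k]

lemma summable_digits (s ω : ℕ → Bool) :
    Summable fun j => (if ω j then step s j else 0 : ℝ) :=
  summable_of_sum_range_le (digit_nonneg s ω) (fun n => leftEnd_le_add s ω 0 n)

lemma tendsto_leftEnd (s ω : ℕ → Bool) : Tendsto (leftEnd s ω) atTop (𝓝 (point s ω)) :=
  (summable_digits s ω).hasSum.tendsto_sum_nat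

lemma leftEnd_le_point (s ω : ℕ → Bool) (k : ℕ) : leftEnd s ω k ≤ point s ω :=
  (leftEnd_mono s ω).ge_of_tendsto (tendsto_leftEnd s ω) k

lemma point_le (s ω : ℕ → Bool) (k : ℕ) : point s ω ≤ leftEnd s ω k + pieceLength s k :=
  le_of_tendsto' (tendsto_leftEnd s ω) (leftEnd_le_add s ω k)

lemma Agree.leftEnd_eq {m : ℕ} {ω ω' : ℕ → Bool} (h : Agree m ω ω') (s : ℕ → Bool) :
    leftEnd s ω m = leftEnd s ω' m :=
  Finset.sum_congr rfl fun j hj => by rw [h j (Finset.mem_range.1 hj)]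

lemma Agree.abs_sub_le {m : ℕ} {ω ω' : ℕ → Bool} (h : Agree m ω ω') (s : ℕ → Bool) :
    |point s ω - point s ω'| ≤ pieceLength s m := by
  have h1 := leftEnd_le_point s ω m
  have h2 := leftEnd_le_point s ω' m
  have h3 := point_le s ω m
  have h4 := point_le s ω' m
  rw [h.leftEnd_eq s] at h1 h3
  rw [abs_le]
  constructor <;> linarith

lemma Agree.abs_sub_le_pow {m : ℕ} {ω ω' : ℕ → Bool} (h : Agree m ω ω') (s : ℕ → Bool) :
    |point s ω - point s ω'| ≤ (1 / 3) ^ m :=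
  (h.abs_sub_le s).trans (pieceLength_le s m)

/-- `ω` comes before `ω'` in the lexicographic order. -/
def Before (ω ω' : ℕ → Bool) (m : ℕ) : Prop := Agree m ω ω' ∧ ω m = false ∧ ω' m = true

/-- The two points lie on either side of the gap removed from a common interval of level `m`. -/
lemma Before.le_sub {ω ω' : ℕ → Bool} {m : ℕ} (h : Before ω ω' m) (s : ℕ → Bool) :
    pieceLength s m - 2 * pieceLength s (m + 1) ≤ point s ω' - point s ω := by
  obtain ⟨h1, h2, h3⟩ := h
  have h4 := point_le s ω (m + 1)
  have h5 := leftEnd_le_point s ω' (m + 1)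
  rw [leftEnd_succ] at h4 h5
  rw [h1.leftEnd_eq s, h2] at h4
  rw [h3] at h5
  simp only [if_true, step] at h4 h5
  simp at h4
  linarith

/-- The worst case is a shrunk parent with unshrunk children, where the removed gap is
$5/7-2/3=1/21$ of $3^{-m}$. -/
lemma Before.pow_le_sub {ω ω' : ℕ → Bool} {m : ℕ} (h : Before ω ω' m) (s : ℕ → Bool) :
    1 / 21 * (1 / 3) ^ m ≤ point s ω' - point s ω := by
  refine le_trans ?_ (h.le_sub s)
  have h1 := le_pieceLength s m
  have h2 := pieceLength_le s (m + 1)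
  rw [pow_succ] at h2
  linarith

lemma Before.pow_le_sub_cantorSeq {ω ω' : ℕ → Bool} {m : ℕ} (h : Before ω ω' m) :
    (1 / 3) ^ (m + 1) ≤ point cantorSeq ω' - point cantorSeq ω := by
  refine le_trans ?_ (h.le_sub _)
  simp only [pieceLength, cantorSeq, pow_succ]
  simp
  linarith

lemma Before.lt {ω ω' : ℕ → Bool} {m : ℕ} (h : Before ω ω' m) (s : ℕ → Bool) :
    point s ω < point s ω' := by
  have h1 := h.pow_le_sub s
  have : (0 : ℝ) < (1 / 3) ^ m := by positivity
  linarith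

/-- Addresses that differ among the first `K` letters are lexicographically comparable. -/
lemma exists_before {K : ℕ} {ω ω' : ℕ → Bool} (h : ¬ Agree K ω ω') :
    ∃ m < K, Before ω ω' m ∨ Before ω' ω m := by
  have h' : ∃ j, j < K ∧ ω j ≠ ω' j := by
    simpa [Agree] using h
  classical
  have hs := Nat.find_spec h'
  have hm := fun j => Nat.find_min (m := j) h'
  set m := Nat.find h'
  have ha : Agree m ω ω' := fun j hj => by
    by_contra hne
    exact hm j hj ⟨hj.trans hs.1, hne⟩
  refine ⟨m, hs.1, ?_⟩
  rcases h0 : ω m with _ | _ <;> rcases h1 : ω' m with _ | _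
  · exact absurd (h0.trans h1.symm) hs.2
  · exact Or.inl ⟨ha, h0, h1⟩
  · exact Or.inr ⟨ha.symm, h1, h0⟩
  · exact absurd (h0.trans h1.symm) hs.2

lemma exists_before_of_ne {ω ω' : ℕ → Bool} (h : ω ≠ ω') :
    ∃ m, Before ω ω' m ∨ Before ω' ω m := by
  obtain ⟨j, hj⟩ := Function.ne_iff.1 h
  obtain ⟨m, -, hm⟩ := exists_before (K := j + 1) (fun ha => hj (ha j (Nat.lt_succ_self j)))
  exact ⟨m, hm⟩

lemma pow_le_abs_sub {K : ℕ} {ω ω' : ℕ → Bool} (h : ¬ Agree (K + 1) ω ω') (s : ℕ → Bool) :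
    1 / 21 * (1 / 3) ^ K ≤ |point s ω - point s ω'| := by
  obtain ⟨m, hm, hb⟩ := exists_before h
  have : (1 / 3 : ℝ) ^ K ≤ (1 / 3) ^ m :=
    pow_le_pow_of_le_one (by norm_num) (by norm_num) (by omega)
  rcases hb with hb | hb
  · have := hb.pow_le_sub s
    rw [abs_sub_comm]
    exact le_trans (by linarith) (le_abs_self _)
  · have := hb.pow_le_sub s
    exact le_trans (by linarith) (le_abs_self _)

lemma pow_le_abs_sub_cantorSeq {K : ℕ} {ω ω' : ℕ → Bool} (h : ¬ Agree K ω ω') :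
    (1 / 3) ^ K ≤ |point cantorSeq ω - point cantorSeq ω'| := by
  obtain ⟨m, hm, hb⟩ := exists_before h
  have : (1 / 3 : ℝ) ^ K ≤ (1 / 3) ^ (m + 1) :=
    pow_le_pow_of_le_one (by norm_num) (by norm_num) (by omega)
  rcases hb with hb | hb
  · have := hb.pow_le_sub_cantorSeq
    rw [abs_sub_comm]
    exact le_trans (by linarith) (le_abs_self _)
  · have := hb.pow_le_sub_cantorSeq
    exact le_trans (by linarith) (le_abs_self _)

lemma point_injective (s : ℕ → Bool) : Function.Injective (point s) := by
  intro ω ω' h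
  by_contra hne
  obtain ⟨m, hb | hb⟩ := exists_before_of_ne hne
  · exact (hb.lt s).ne h
  · exact (hb.lt s).ne' h

/-- The order of the points is that of their addresses, for every modified Cantor set. -/
lemma point_le_point_iff (s s' : ℕ → Bool) (ω ω' : ℕ → Bool) :
    point s ω ≤ point s ω' ↔ point s' ω ≤ point s' ω' := by
  by_cases h : ω = ω'
  · simp [h]
  obtain ⟨m, hb | hb⟩ := exists_before_of_ne h
  · exact iff_of_true (hb.lt s).le (hb.lt s').le
  · exact iff_of_false (hb.lt s).not_ge (hb.lt s').not_ge

/-- Cells of level `m` are convex. -/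
lemma point_lt_of_not_agree {s : ℕ → Bool} {m : ℕ} {ω ω' ω'' : ℕ → Bool} (h : Agree m ω ω')
    (h' : ¬ Agree m ω ω'') (hlt : point s ω ≤ point s ω'') : point s ω' < point s ω'' := by
  obtain ⟨j, hj, hb | hb⟩ := exists_before h'
  · refine Before.lt (m := j) ⟨fun i hi => ?_, ?_, hb.2.2⟩ s
    · rw [← h i (hi.trans hj), hb.1 i hi]
    · rw [← h j hj, hb.2.1]
  · exact absurd hlt (hb.lt s).not_ge

/-- Where `s` is constant, the modified Cantor set is a scaled copy of the middle-thirds Cantor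
set, up to a finer scale. -/
lemma Agree.abs_sub_scale_le {s : ℕ → Bool} {b : Bool} {m k : ℕ} (hmk : m ≤ k)
    (hs : ∀ j, m ≤ j → j ≤ k → s j = b) {ω ω' : ℕ → Bool} (h : Agree m ω ω') :
    |(point s ω - point s ω') - (if b then 5 / 7 else 1) *
      (point cantorSeq ω - point cantorSeq ω')| ≤ 2 * (1 / 3) ^ k := by
  have hstep : ∀ j, m ≤ j → j < k →
      step s j = (if b then 5 / 7 else 1) * step cantorSeq j := fun j h1 h2 => by
    simp only [step, pieceLength, hs j h1 h2.le, hs (j + 1) (by omega) h2, cantorSeq]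
    rcases b
    · simp
    · simp; ring
  -- Up to level `k` the scaling of left ends is exact. The error comes only from the position of
  -- the points inside their intervals of level `k`, of length at most $3^{-k}$ in each set.
  have hdiff : ∀ j, m ≤ j → j ≤ k → leftEnd s ω j - leftEnd s ω' j =
      (if b then 5 / 7 else 1) * (leftEnd cantorSeq ω j - leftEnd cantorSeq ω' j) := by
    intro j hj
    induction j, hj using Nat.le_induction with
    | base => intro _; rw [h.leftEnd_eq s, h.leftEnd_eq cantorSeq]; simp
    | succ j hj ih =>
      intro hjk
      have ih := ih (by omega)
      simp only [leftEnd_succ, hstep j hj hjk]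
      generalize (if b then 5 / 7 else 1 : ℝ) = c at ih ⊢
      rcases ω j <;> rcases ω' j <;> simp <;> linarith
  have hd := hdiff k hmk le_rfl
  have e1 := leftEnd_le_point s ω k
  have e2 := leftEnd_le_point s ω' k
  have e3 := point_le s ω k
  have e4 := point_le s ω' k
  have f1 := leftEnd_le_point cantorSeq ω k
  have f2 := leftEnd_le_point cantorSeq ω' k
  have f3 := point_le cantorSeq ω k
  have f4 := point_le cantorSeq ω' k
  have g1 := pieceLength_le s k
  have g2 := pieceLength_le cantorSeq k
  rw [abs_le]
  rcases b with _ | _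
  · simp only [Bool.false_eq_true, if_false, one_mul] at *
    constructor <;> linarith
  · simp only [if_true] at *
    constructor <;> linarith

lemma continuous_point (s : ℕ → Bool) : Continuous (point s) := by
  rw [continuous_iff_continuousAt]
  intro ω
  rw [ContinuousAt, Metric.tendsto_nhds]
  intro ε hε
  obtain ⟨m, hm⟩ := exists_pow_lt_of_lt_one hε (show (1 / 3 : ℝ) < 1 by norm_num)
  have hU : {ω' : ℕ → Bool | Agree m ω' ω} ∈ 𝓝 ω := by
    have : {ω' : ℕ → Bool | Agree m ω' ω} = ⋂ j ∈ Finset.range m, {ω' | ω' j = ω j} := by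
      ext; simp [Agree]
    rw [this]
    refine (Filter.biInter_finset_mem _).2 fun j _ => ?_
    exact (continuous_apply j).continuousAt.preimage_mem_nhds
      ((isOpen_discrete {ω j}).mem_nhds rfl)
  filter_upwards [hU] with ω' h
  exact lt_of_le_of_lt (h.abs_sub_le_pow s) hm

/-! ### The natural measure -/

/-- The law of a sequence of fair coin tosses. -/
noncomputable def coin : Measure (ℕ → Bool) :=
  Measure.infinitePi fun _ : ℕ => (PMF.uniformOfFintype Bool).toMeasure

instance : IsProbabilityMeasure coin := by unfold coin; infer_instance

lemma coin_agree (m : ℕ) (ω : ℕ → Bool) : coin {ω' | Agree m ω ω'} = (2⁻¹ : ENNReal) ^ m := by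
  have : {ω' : ℕ → Bool | Agree m ω ω'} = (Finset.range m : Set ℕ).pi fun j => {ω j} := by
    ext ω'
    simp [Agree, Set.mem_pi, eq_comm]
  rw [this, coin, Measure.infinitePi_pi _ (fun _ _ => measurableSet_singleton _)]
  simp

lemma measurableSet_agree (m : ℕ) : MeasurableSet {p : (ℕ → Bool) × (ℕ → Bool) |
    Agree m p.1 p.2} := by
  have : {p : (ℕ → Bool) × (ℕ → Bool) | Agree m p.1 p.2} =
      ⋂ j ∈ Finset.range m, {p | p.1 j = p.2 j} := by
    ext; simp [Agree]
  rw [this]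
  refine Finset.measurableSet_biInter _ fun j _ => measurableSet_eq_fun ?_ ?_ <;> fun_prop

/-- The image of the coin tossing measure on the modified Cantor set. -/
noncomputable def naturalMeasure (s : ℕ → Bool) : Measure ℝ := coin.map (point s)

lemma measurable_point (s : ℕ → Bool) : Measurable (point s) := (continuous_point s).measurable

instance (s : ℕ → Bool) : IsProbabilityMeasure (naturalMeasure s) :=
  Measure.isProbabilityMeasure_map (measurable_point s).aemeasurable

lemma leftEnds_eq (s : ℕ → Bool) (k : ℕ) : leftEnds s k = range fun ω => leftEnd s ω k := by
  induction k with
  | zero => ext x; simp [leftEnds, leftEnd]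
  | succ k ih =>
    rw [leftEnds, ih]
    ext x
    simp only [mem_union, mem_range, mem_image, exists_exists_eq_and, leftEnd_succ]
    have key : ∀ (ω : ℕ → Bool) (b : Bool), leftEnd s (Function.update ω k b) k = leftEnd s ω k :=
      fun ω b => Agree.leftEnd_eq (fun j hj => Function.update_of_ne hj.ne _ _) s
    constructor
    · rintro (⟨ω, rfl⟩ | ⟨ω, rfl⟩)
      · exact ⟨Function.update ω k false, by simp [key]⟩
      · exact ⟨Function.update ω k true, by simp [key, step]⟩
    · rintro ⟨ω, rfl⟩
      rcases h : ω k
      · exact Or.inl ⟨ω, by simp⟩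
      · exact Or.inr ⟨ω, by simp [step]⟩

lemma point_zeros (s ω : ℕ → Bool) (k : ℕ) :
    point s (fun j => if j < k then ω j else false) = leftEnd s ω k := by
  unfold point leftEnd
  rw [tsum_eq_sum (s := Finset.range k)]
  · refine Finset.sum_congr rfl fun j hj => ?_
    simp [Finset.mem_range.1 hj]
  · intro j hj
    simp [Finset.mem_range.not.1 hj]

/-- The range is compact, and left ends belong to it by `point_zeros`; a point of the intersection
is approximated by the left ends of the intervals containing it. -/
lemma modifiedCantorSet_eq (s : ℕ → Bool) : modifiedCantorSet s = range (point s) := by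
  apply Subset.antisymm
  · intro x hx
    have hcl : IsClosed (range (point s)) := (isCompact_range (continuous_point s)).isClosed
    rw [← hcl.closure_eq, Metric.mem_closure_iff]
    intro ε hε
    obtain ⟨m, hm⟩ := exists_pow_lt_of_lt_one hε (show (1 / 3 : ℝ) < 1 by norm_num)
    obtain ⟨I, ⟨a, ha, rfl⟩, hxI⟩ := mem_iInter.1 hx m
    rw [leftEnds_eq] at ha
    obtain ⟨ω, rfl⟩ := ha
    refine ⟨_, ⟨_, point_zeros s ω m⟩, ?_⟩
    have := pieceLength_le s m
    simp only [mem_Icc] at hxI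
    rw [Real.dist_eq, abs_lt]
    constructor <;> linarith
  · rintro _ ⟨ω, rfl⟩
    refine mem_iInter.2 fun k => ⟨_, ⟨leftEnd s ω k, ?_, rfl⟩, leftEnd_le_point s ω k,
      point_le s ω k⟩
    rw [leftEnds_eq]
    exact ⟨ω, rfl⟩

/-- Since the removed gaps have positive length, distinct intervals of the same level are disjoint.
-/
lemma preimage_piece (s ω : ℕ → Bool) (k : ℕ) :
    point s ⁻¹' Icc (leftEnd s ω k) (leftEnd s ω k + pieceLength s k) = {ω' | Agree k ω ω'} := by
  ext ω'
  simp only [mem_preimage, mem_Icc, mem_ofPred_eq]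
  constructor
  · rintro ⟨h1, h2⟩
    by_contra hna
    obtain ⟨m, hm, hb | hb⟩ := exists_before hna
    · have e1 := leftEnd_mono s ω (show m + 1 ≤ k from hm)
      have e2 := rightEnd_antitone s ω (show m + 1 ≤ k from hm)
      simp only [leftEnd_succ, hb.2.1] at e2
      have e3 := leftEnd_le_point s ω' (m + 1)
      rw [leftEnd_succ, hb.2.2, ← hb.1.leftEnd_eq s] at e3
      simp only [if_true, step] at e3
      have e4 := le_pieceLength s m
      have e5 := pieceLength_le s (m + 1)
      have : (0 : ℝ) < (1 / 3) ^ m := by positivity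
      rw [pow_succ] at e5
      simp at e2
      linarith
    · have e1 := leftEnd_mono s ω (show m + 1 ≤ k from hm)
      rw [leftEnd_succ, hb.2.2] at e1
      simp only [if_true, step] at e1
      have e3 := point_le s ω' (m + 1)
      rw [leftEnd_succ, hb.2.1, hb.1.leftEnd_eq s] at e3
      have e4 := le_pieceLength s m
      have e5 := pieceLength_le s (m + 1)
      have : (0 : ℝ) < (1 / 3) ^ m := by positivity
      rw [pow_succ] at e5
      simp at e3
      linarith
  · intro h
    rw [h.leftEnd_eq s]
    exact ⟨leftEnd_le_point s ω' k, point_le s ω' k⟩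

lemma isNaturalMeasure_naturalMeasure (s : ℕ → Bool) : IsNaturalMeasure s (naturalMeasure s) where
  isProbabilityMeasure := inferInstance
  measure_piece := by
    rintro k _ ⟨a, ha, rfl⟩
    rw [leftEnds_eq] at ha
    obtain ⟨ω, rfl⟩ := ha
    rw [naturalMeasure, Measure.map_apply (measurable_point s) measurableSet_Icc]
    exact (congrArg coin (preimage_piece s ω k)).trans (coin_agree k ω)

/-! ### Masses of balls, support and Ahlfors regularity -/

lemma pow_le_measure_ball (s ω : ℕ → Bool) {k : ℕ} {δ : ℝ} (hδ : (1 / 3) ^ k < δ) :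
    (2⁻¹ : ENNReal) ^ k ≤ naturalMeasure s (Metric.ball (point s ω) δ) := by
  rw [naturalMeasure, Measure.map_apply (measurable_point s) Metric.isOpen_ball.measurableSet,
    ← coin_agree k ω]
  refine measure_mono fun ω' h => ?_
  exact lt_of_le_of_lt (h.symm.abs_sub_le_pow s) hδ

/-- A ball this small meets no cell of level `k + 1` other than that of its centre. -/
lemma measure_ball_le (s ω : ℕ → Bool) {k : ℕ} {δ : ℝ} (hδ : δ ≤ 1 / 21 * (1 / 3) ^ k) :
    naturalMeasure s (Metric.ball (point s ω) δ) ≤ (2⁻¹ : ENNReal) ^ (k + 1) := by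
  rw [naturalMeasure, Measure.map_apply (measurable_point s) Metric.isOpen_ball.measurableSet,
    ← coin_agree (k + 1) ω]
  refine measure_mono fun ω' h => ?_
  by_contra hna
  have h1 : |point s ω' - point s ω| < δ := h
  have h2 := pow_le_abs_sub hna s
  rw [abs_sub_comm] at h2
  linarith

lemma support_naturalMeasure (s : ℕ → Bool) :
    (naturalMeasure s).support = range (point s) := by
  apply Subset.antisymm
  · have hcl : IsClosed (range (point s)) := (isCompact_range (continuous_point s)).isClosed
    refine Measure.support_subset_of_isClosed hcl ?_
    rw [mem_ae_iff, naturalMeasure,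
      Measure.map_apply (measurable_point s) hcl.measurableSet.compl]
    convert measure_empty (μ := coin)
    ext ω
    simp
  · rintro _ ⟨ω, rfl⟩
    rw [Metric.nhds_basis_ball.mem_measureSupport]
    intro ε hε
    obtain ⟨m, hm⟩ := exists_pow_lt_of_lt_one hε (show (1 / 3 : ℝ) < 1 by norm_num)
    exact lt_of_lt_of_le (ENNReal.pow_pos (by simp) m) (pow_le_measure_ball s ω hm)

lemma range_point_subset (s : ℕ → Bool) : range (point s) ⊆ Icc 0 1 := by
  rintro _ ⟨ω, rfl⟩
  have h1 := leftEnd_le_point s ω 0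
  have h2 := point_le s ω 0
  have h3 := pieceLength_le s 0
  simp [leftEnd] at h1 h2 h3
  exact ⟨h1, h2.trans h3⟩

lemma isAhlforsRegular_naturalMeasure {d : ℝ} (hd : (1 / 3 : ℝ) ^ d = 1 / 2) (hd0 : 0 < d)
    (s : ℕ → Bool) : IsAhlforsRegular d (naturalMeasure s) := by
  have hpow : ∀ k : ℕ, ((1 / 3 : ℝ) ^ k) ^ d = (1 / 2) ^ k := fun k => by
    rw [← Real.rpow_natCast, ← Real.rpow_mul (by norm_num), mul_comm, Real.rpow_mul (by norm_num),
      hd, Real.rpow_natCast]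
  have htr : ∀ k : ℕ, ((2⁻¹ : ENNReal) ^ k).toReal = (1 / 2) ^ k := fun k => by simp
  -- With $3^{-(k+1)}<\delta\le3^{-k}$, three levels suffice to absorb the separation constant, as
  -- $3^{-3}<1/21$. The mass is then at most $2^{-(k-2)}$ while $\delta^d\ge2^{-(k+1)}$, whence
  -- $8=2^3$. For $k<3$ the trivial bound 1 on the mass gives the same constant.
  refine ⟨8, by norm_num, 1, one_pos, ?_⟩
  rw [support_naturalMeasure]
  rintro _ ⟨ω, rfl⟩ δ h0 h1
  obtain ⟨k, hk1, hk2⟩ := exists_nat_pow_near_of_lt_one h0 h1.le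
    (show (0 : ℝ) < 1 / 3 by norm_num) (by norm_num)
  have hup : δ ^ d ≤ (1 / 2) ^ k := by
    rw [← hpow k]; exact Real.rpow_le_rpow h0.le hk2 hd0.le
  have hlow : (1 / 2) ^ (k + 1) ≤ δ ^ d := by
    rw [← hpow (k + 1)]; exact Real.rpow_le_rpow (by positivity) hk1.le hd0.le
  have hpos : (0 : ℝ) < (1 / 2) ^ k := by positivity
  constructor
  · have := ENNReal.toReal_mono (measure_ne_top _ _) (pow_le_measure_ball s ω (k := k + 1) hk1)
    rw [htr, pow_succ] at this
    rw [Measure.real]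
    linarith
  · rcases lt_or_ge k 3 with hk | hk
    · have h8 : (1 / 2 : ℝ) ^ 3 ≤ (1 / 2) ^ (k + 1) :=
        pow_le_pow_of_le_one (by norm_num) (by norm_num) (by omega)
      have := measureReal_le_one (μ := naturalMeasure s) (s := Metric.ball (point s ω) δ)
      norm_num at h8 hlow ⊢
      linarith
    · obtain ⟨j, rfl⟩ := Nat.exists_eq_add_of_le' hk
      have hδ : δ ≤ 1 / 21 * (1 / 3) ^ j := by
        have : (0 : ℝ) < (1 / 3) ^ j := by positivity
        rw [pow_add] at hk2
        norm_num at hk2 ⊢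
        norm_num at this
        linarith
      have := ENNReal.toReal_mono (by simp) (measure_ball_le s ω hδ)
      rw [htr] at this
      rw [Measure.real]
      rw [pow_succ] at this
      have e : (1 / 2 : ℝ) ^ (j + 3 + 1) = (1 / 2) ^ j * (1 / 16) := by
        rw [pow_succ, pow_add]; norm_num; ring
      rw [e] at hlow
      linarith

end ModifiedCantor

/-! ### Gaps between consecutive points of the line -/

section NextGap

variable {ι : Type*} [Fintype ι]

open Classical in
/-- The indices `j ≠ i` that are related to `i` and whose points lie to the right of that of `i`. -/
noncomputable def rightIndices (y : ι → ℝ) (R : ι → ι → Prop) (i : ι) : Finset ι :=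
  Finset.univ.filter fun j => j ≠ i ∧ y i ≤ y j ∧ R i j

open Classical in
/-- The distance from `y i` to the next point to its right whose index is related to `i`, and `0`
if there is none. -/
noncomputable def nextGap (y : ι → ℝ) (R : ι → ι → Prop) (i : ι) : ℝ :=
  if h : (rightIndices y R i).Nonempty then (rightIndices y R i).inf' h fun j => y j - y i else 0

variable {y : ι → ℝ} {R R' : ι → ι → Prop} {i j p : ι}

lemma mem_rightIndices : j ∈ rightIndices y R i ↔ j ≠ i ∧ y i ≤ y j ∧ R i j := by
  simp [rightIndices]

lemma nextGap_le (h : j ∈ rightIndices y R i) : nextGap y R i ≤ y j - y i := by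
  rw [nextGap, dif_pos ⟨j, h⟩]
  exact Finset.inf'_le _ h

lemma exists_nextGap_eq (h : (rightIndices y R i).Nonempty) :
    ∃ j ∈ rightIndices y R i, nextGap y R i = y j - y i := by
  rw [nextGap, dif_pos h]
  obtain ⟨j, hj, e⟩ := Finset.exists_mem_eq_inf' h fun j => y j - y i
  exact ⟨j, hj, e⟩

lemma nextGap_eq_zero (h : ¬ (rightIndices y R i).Nonempty) : nextGap y R i = 0 := by
  rw [nextGap, dif_neg h]

lemma nextGap_nonneg : 0 ≤ nextGap y R i := by
  by_cases h : (rightIndices y R i).Nonempty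
  · obtain ⟨j, hj, e⟩ := exists_nextGap_eq h
    rw [e]
    exact sub_nonneg.2 (mem_rightIndices.1 hj).2.1
  · rw [nextGap_eq_zero h]

lemma nextGap_le_of_forall {B : ℝ} (hB : 0 ≤ B) (h : ∀ j, R i j → y j - y i ≤ B) :
    nextGap y R i ≤ B := by
  by_cases h' : (rightIndices y R i).Nonempty
  · obtain ⟨j, hj, e⟩ := exists_nextGap_eq h'
    rw [e]
    exact h j (mem_rightIndices.1 hj).2.2
  · rwa [nextGap_eq_zero h']

lemma le_nextGap {B : ℝ} (h' : (rightIndices y R i).Nonempty)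
    (h : ∀ j ∈ rightIndices y R i, B ≤ y j - y i) : B ≤ nextGap y R i := by
  obtain ⟨j, hj, e⟩ := exists_nextGap_eq h'
  rw [e]
  exact h j hj

/-- Subadditivity of $t\mapsto t^\alpha$ for $\alpha\le1$. -/
lemma abs_rpow_sub_rpow_le {a b α : ℝ} (ha : 0 ≤ a) (hb : 0 ≤ b) (h0 : 0 ≤ α) (h1 : α ≤ 1) :
    |a ^ α - b ^ α| ≤ |a - b| ^ α := by
  wlog hab : b ≤ a generalizing a b
  · rw [abs_sub_comm, abs_sub_comm a]
    exact this hb ha (le_of_not_ge hab)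
  rw [abs_of_nonneg (sub_nonneg.2 hab),
    abs_of_nonneg (sub_nonneg.2 (Real.rpow_le_rpow hb hab h0))]
  have := Real.rpow_add_le_add_rpow (sub_nonneg.2 hab) hb h0 h1
  rw [sub_add_cancel] at this
  linarith

/-- Forgetting the index `p` changes the next gap only at the predecessor of `p`. -/
lemma lt_of_nextGap_ne (h : nextGap y R i ≠ nextGap y (fun i j => R i j ∧ j ≠ p) i) :
    p ∈ rightIndices y R i ∧ ∀ j ∈ rightIndices y R i, j ≠ p → y p < y j := by
  have hp : p ∈ rightIndices y R i := by
    by_contra hp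
    refine h ?_
    have : rightIndices y R i = rightIndices y (fun i j => R i j ∧ j ≠ p) i := by
      ext j
      simp only [mem_rightIndices]
      constructor
      · rintro ⟨h1, h2, h3⟩
        exact ⟨h1, h2, h3, fun e => hp (e ▸ mem_rightIndices.2 ⟨h1, h2, h3⟩)⟩
      · rintro ⟨h1, h2, h3, -⟩
        exact ⟨h1, h2, h3⟩
    unfold nextGap
    simp only [this]
  refine ⟨hp, fun j hj hjp => ?_⟩
  by_contra hle
  push Not at hle
  refine h ?_
  have hj' : j ∈ rightIndices y (fun i j => R i j ∧ j ≠ p) i := by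
    rw [mem_rightIndices] at hj ⊢
    exact ⟨hj.1, hj.2.1, hj.2.2, hjp⟩
  apply le_antisymm
  · obtain ⟨k, hk, e⟩ := exists_nextGap_eq ⟨j, hj'⟩
    rw [e]
    rw [mem_rightIndices] at hk
    exact nextGap_le (mem_rightIndices.2 ⟨hk.1, hk.2.1, hk.2.2.1⟩)
  · obtain ⟨k, hk, e⟩ := exists_nextGap_eq ⟨j, hj⟩
    rw [e]
    by_cases hkp : k = p
    · subst hkp
      linarith [nextGap_le hj']
    · rw [mem_rightIndices] at hk
      exact nextGap_le (mem_rightIndices.2 ⟨hk.1, hk.2.1, hk.2.2, hkp⟩)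

lemma abs_rpow_sub_rpow_le_of_le {a b B α : ℝ} (ha : 0 ≤ a) (hb : 0 ≤ b) (haB : a ≤ B)
    (hbB : b ≤ B) (h0 : 0 ≤ α) : |a ^ α - b ^ α| ≤ B ^ α := by
  have h1 := Real.rpow_le_rpow ha haB h0
  have h2 := Real.rpow_le_rpow hb hbB h0
  have h3 := Real.rpow_nonneg ha α
  have h4 := Real.rpow_nonneg hb α
  rw [abs_le]
  constructor <;> linarith

open Classical in
/-- The influence of a single point on the sum of the powers of the gaps. -/
lemma abs_sum_nextGap_sub_le {α B : ℝ} (hα : 0 ≤ α) (hB : 0 ≤ B)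
    (hsymm : ∀ i j, R i j → R j i) (htrans : ∀ i j k, R i j → R j k → R i k)
    (hRB : ∀ i j, R i j → y j - y i ≤ B) (p : ι) :
    |∑ i, nextGap y R i ^ α -
      ∑ i ∈ Finset.univ.erase p, nextGap y (fun i j => R i j ∧ j ≠ p) i ^ α| ≤ 2 * B ^ α := by
  set g := fun i => nextGap y R i with hg
  set g' := fun i => nextGap y (fun i j => R i j ∧ j ≠ p) i with hg'
  have hgB : ∀ i, g i ≤ B := fun i => nextGap_le_of_forall hB (hRB i)
  have hgB' : ∀ i, g' i ≤ B := fun i => nextGap_le_of_forall hB fun j h => hRB i j h.1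
  have hg0 : ∀ i, 0 ≤ g i := fun i => nextGap_nonneg
  have hg0' : ∀ i, 0 ≤ g' i := fun i => nextGap_nonneg
  have hterm : |g p ^ α| ≤ B ^ α := by
    rw [abs_of_nonneg (Real.rpow_nonneg (hg0 p) α)]
    exact Real.rpow_le_rpow (hg0 p) (hgB p) hα
  have hrest : |∑ i ∈ Finset.univ.erase p, (g i ^ α - g' i ^ α)| ≤ B ^ α := by
    -- At most one index other than `p` is affected. Two of them would be related to each other
    -- through `p`, and the one further right would come before `p` as seen from the other.
    by_cases hex : ∃ q ∈ Finset.univ.erase p, g q ≠ g' q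
    · obtain ⟨q, hq, hne⟩ := hex
      rw [Finset.sum_eq_single_of_mem q hq]
      · exact abs_rpow_sub_rpow_le_of_le (hg0 q) (hg0' q) (hgB q) (hgB' q) hα
      · intro i hi hiq
        by_contra hne2
        have hne' : g i ≠ g' i := fun e => hne2 (by rw [e, sub_self])
        obtain ⟨a1, a2⟩ := lt_of_nextGap_ne hne
        obtain ⟨b1, b2⟩ := lt_of_nextGap_ne hne'
        have hip := Finset.ne_of_mem_erase hi
        have hqp := Finset.ne_of_mem_erase hq
        rw [mem_rightIndices] at a1 b1
        rcases le_total (y i) (y q) with h | h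
        · have := b2 q (mem_rightIndices.2
            ⟨hiq.symm, h, htrans _ _ _ b1.2.2 (hsymm _ _ a1.2.2)⟩) hqp
          linarith [a1.2.1]
        · have := a2 i (mem_rightIndices.2
            ⟨hiq, h, htrans _ _ _ a1.2.2 (hsymm _ _ b1.2.2)⟩) hip
          linarith [b1.2.1]
    · push Not at hex
      rw [Finset.sum_eq_zero fun i hi => by rw [hex i hi, sub_self], abs_zero]
      exact Real.rpow_nonneg hB α
  rw [← Finset.add_sum_erase _ _ (Finset.mem_univ p), add_sub_assoc, ← Finset.sum_sub_distrib]
  calc _ ≤ |g p ^ α| + |∑ i ∈ Finset.univ.erase p, (g i ^ α - g' i ^ α)| := abs_add_le _ _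
    _ ≤ 2 * B ^ α := by linarith

lemma nextGap_congr {y' : ι → ℝ} (hi : y i = y' i) (hy : ∀ j, R i j → y j = y' j)
    (hR : ∀ j, R i j ↔ R' i j) : nextGap y R i = nextGap y' R' i := by
  have h : rightIndices y R i = rightIndices y' R' i := by
    ext j
    simp only [mem_rightIndices, ← hR, ← hi]
    constructor
    · rintro ⟨h1, h2, h3⟩
      exact ⟨h1, hy j h3 ▸ h2, h3⟩
    · rintro ⟨h1, h2, h3⟩
      exact ⟨h1, hy j h3 ▸ h2, h3⟩
  unfold nextGap
  simp only [h, hi]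
  split_ifs with h'
  · refine Finset.inf'_congr h' rfl fun j hj => ?_
    rw [← h, mem_rightIndices] at hj
    rw [hy j hj.2.2]
  · rfl

/-- The set of competing indices takes finitely many values and depends measurably on the sample;
for a fixed value the gap is a finite minimum. -/
lemma measurable_nextGap {Ω : Type*} [MeasurableSpace Ω] {Y : Ω → ι → ℝ}
    {Q : Ω → ι → ι → Prop} (hY : ∀ i, Measurable fun ω => Y ω i)
    (hQ : ∀ i j, MeasurableSet {ω | Q ω i j}) (i : ι) :
    Measurable fun ω => nextGap (Y ω) (Q ω) i := by
  classical
  let _ : MeasurableSpace (Finset ι) := ⊤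
  have hc : Measurable fun ω => rightIndices (Y ω) (Q ω) i := by
    refine measurable_to_countable' fun A => ?_
    have : (fun ω => rightIndices (Y ω) (Q ω) i) ⁻¹' {A} =
        ⋂ j, {ω | (j ≠ i ∧ Y ω i ≤ Y ω j ∧ Q ω i j) ↔ j ∈ A} := by
      ext ω
      simp [Finset.ext_iff, mem_rightIndices]
    rw [this]
    refine MeasurableSet.iInter fun j => ?_
    have hm : MeasurableSet {ω | j ≠ i ∧ Y ω i ≤ Y ω j ∧ Q ω i j} :=
      (MeasurableSet.const _).inter ((measurableSet_le (hY i) (hY j)).inter (hQ i j))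
    by_cases hj : j ∈ A
    · simpa [hj] using hm
    · simp only [hj, iff_false]
      exact hm.compl
  have hg : Measurable fun q : Finset ι × Ω =>
      if h : q.1.Nonempty then q.1.inf' h fun j => Y q.2 j - Y q.2 i else 0 := by
    refine measurable_from_prod_countable_right fun A => ?_
    by_cases h : A.Nonempty
    · simp only [h, dif_pos]
      induction h using Finset.Nonempty.cons_induction with
      | singleton j =>
        simp only [Finset.inf'_singleton]
        exact (hY j).sub (hY i)
      | cons j A hj hA ih =>
        simp only [Finset.inf'_cons hA]
        exact ((hY j).sub (hY i)).inf ih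
    · simp only [h, dif_neg, not_false_iff]
      exact measurable_const
  exact hg.comp (hc.prodMk measurable_id)

end NextGap

/-! ### Sums of gaps inside the cells of a level -/

namespace ModifiedCantor

variable {n : ℕ}

/-- Next gap of a sample within its cell of level `m`. -/
noncomputable def cellGap (s : ℕ → Bool) (m : ℕ) (x : Fin n → ℕ → Bool) (i : Fin n) : ℝ :=
  nextGap (fun i => point s (x i)) (fun i j => Agree m (x i) (x j)) i

/-- The sum of the `α`-th powers of the gaps between consecutive points in the same cell of
level `m`. -/
noncomputable def gapSum (α : ℝ) (s : ℕ → Bool) (m : ℕ) (x : Fin n → ℕ → Bool) : ℝ :=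
  ∑ i, cellGap s m x i ^ α

/-- The samples to the right of `x i` in its cell of level `m`. -/
noncomputable def cellRight (s : ℕ → Bool) (m : ℕ) (x : Fin n → ℕ → Bool) (i : Fin n) :
    Finset (Fin n) :=
  rightIndices (fun i => point s (x i)) (fun i j => Agree m (x i) (x j)) i

lemma mem_cellRight {s : ℕ → Bool} {m : ℕ} {x : Fin n → ℕ → Bool} {i j : Fin n} :
    j ∈ cellRight s m x i ↔ j ≠ i ∧ point s (x i) ≤ point s (x j) ∧ Agree m (x i) (x j) :=
  mem_rightIndices

lemma cellGap_nonneg (s : ℕ → Bool) (m : ℕ) (x : Fin n → ℕ → Bool) (i : Fin n) :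
    0 ≤ cellGap s m x i := nextGap_nonneg

lemma cellGap_le (s : ℕ → Bool) (m : ℕ) (x : Fin n → ℕ → Bool) (i : Fin n) :
    cellGap s m x i ≤ (1 / 3) ^ m :=
  nextGap_le_of_forall (by positivity) fun _ h =>
    (le_abs_self _).trans (h.symm.abs_sub_le_pow s)

lemma gapSum_nonneg (α : ℝ) (s : ℕ → Bool) (m : ℕ) (x : Fin n → ℕ → Bool) :
    0 ≤ gapSum α s m x :=
  Finset.sum_nonneg fun i _ => Real.rpow_nonneg (cellGap_nonneg s m x i) α

lemma gapSum_le {α : ℝ} (hα : 0 ≤ α) (s : ℕ → Bool) (m : ℕ) (x : Fin n → ℕ → Bool) :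
    gapSum α s m x ≤ n * ((1 / 3) ^ m) ^ α := by
  have : ∀ i ∈ (Finset.univ : Finset (Fin n)), cellGap s m x i ^ α ≤ ((1 / 3) ^ m) ^ α :=
    fun i _ => Real.rpow_le_rpow (cellGap_nonneg s m x i) (cellGap_le s m x i) hα
  have h := Finset.sum_le_card_nsmul _ _ _ this
  rwa [Finset.card_univ, Fintype.card_fin, nsmul_eq_mul] at h

lemma measurable_gapSum (α : ℝ) (s : ℕ → Bool) (m : ℕ) :
    Measurable fun x : Fin n → ℕ → Bool => gapSum α s m x := by
  refine Finset.measurable_fun_sum _ fun i _ => Measurable.pow_const ?_ α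
  refine measurable_nextGap (fun i => (measurable_point s).comp (measurable_pi_apply i))
    (fun i j => ?_) i
  exact measurableSet_preimage (f := fun x : Fin n → ℕ → Bool => (x i, x j)) (by fun_prop)
    (measurableSet_agree m)

/-- The bounded difference property of `gapSum`. -/
lemma abs_gapSum_update_sub_le {α : ℝ} (hα : 0 ≤ α) (s : ℕ → Bool) (m : ℕ)
    (x : Fin n → ℕ → Bool) (p : Fin n) (z : ℕ → Bool) :
    |gapSum α s m x - gapSum α s m (Function.update x p z)| ≤ 4 * ((1 / 3) ^ m) ^ α := by
  -- Both samples are compared with the common sample from which `p` is deleted, each at cost 2.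
  have key : ∀ x : Fin n → ℕ → Bool, |gapSum α s m x - ∑ i ∈ Finset.univ.erase p,
      nextGap (fun i => point s (x i)) (fun i j => Agree m (x i) (x j) ∧ j ≠ p) i ^ α| ≤
        2 * ((1 / 3) ^ m) ^ α := fun x => by
    have := abs_sum_nextGap_sub_le (y := fun i => point s (x i))
      (R := fun i j => Agree m (x i) (x j)) hα (B := (1 / 3) ^ m) (by positivity)
      (fun i j h => h.symm) (fun i j k h h' => h.trans h')
      (fun i j h => (le_abs_self _).trans (h.symm.abs_sub_le_pow s)) p
    simp only [gapSum, cellGap]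
    convert this
  have h1 := key x
  have h2 := key (Function.update x p z)
  have h3 : ∑ i ∈ Finset.univ.erase p,
      nextGap (fun i => point s (x i)) (fun i j => Agree m (x i) (x j) ∧ j ≠ p) i ^ α =
    ∑ i ∈ Finset.univ.erase p, nextGap (fun i => point s (Function.update x p z i))
      (fun i j => Agree m (Function.update x p z i) (Function.update x p z j) ∧ j ≠ p) i ^ α := by
    refine Finset.sum_congr rfl fun i hi => ?_
    have hip := Finset.ne_of_mem_erase hi
    congr 1
    refine nextGap_congr ?_ (fun j hj => ?_) fun j => ?_
    · simp [Function.update_of_ne hip]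
    · simp [Function.update_of_ne hj.2]
    · by_cases hj : j = p
      · simp [hj]
      · simp [Function.update_of_ne hip, Function.update_of_ne hj]
  rw [← h3] at h2
  rw [abs_le] at *
  constructor <;> linarith

open Classical in
/-- At most one sample in each cell has no other sample of the cell to its right. -/
lemma card_cellRight_empty_le (s : ℕ → Bool) (m : ℕ) (x : Fin n → ℕ → Bool) :
    (Finset.univ.filter fun i => ¬ (cellRight s m x i).Nonempty).card ≤ 2 ^ m := by
  have : (2 : ℕ) ^ m = (Finset.univ : Finset (Fin m → Bool)).card := by simp
  rw [this]
  refine Finset.card_le_card_of_injOn (fun i j => x i j) (fun _ _ => Finset.mem_coe.2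
    (Finset.mem_univ _)) ?_
  intro i hi i' hi' h
  simp only [Finset.coe_filter, Finset.mem_univ, true_and, mem_ofPred_eq] at hi hi'
  have ha : Agree m (x i) (x i') := fun j hj => congrFun h ⟨j, hj⟩
  by_contra hne
  rcases le_total (point s (x i)) (point s (x i')) with hle | hle
  · exact hi ⟨i', mem_cellRight.2 ⟨Ne.symm hne, hle, ha⟩⟩
  · exact hi' ⟨i, mem_cellRight.2 ⟨hne, hle, ha.symm⟩⟩

/-- Cells are convex for the order: if the finer cell contains a sample further right, the nearest
one in the coarser cell already lies in the finer cell. -/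
lemma cellGap_eq_of_nonempty {s : ℕ → Bool} {m m' : ℕ} (hm : m ≤ m') {x : Fin n → ℕ → Bool}
    {i : Fin n} (h : (cellRight s m' x i).Nonempty) : cellGap s m x i = cellGap s m' x i := by
  have hsub : ∀ j, j ∈ cellRight s m' x i → j ∈ cellRight s m x i := fun j hj => by
    rw [mem_cellRight] at *
    exact ⟨hj.1, hj.2.1, hj.2.2.mono hm⟩
  obtain ⟨j, hj, e⟩ := exists_nextGap_eq h
  apply le_antisymm
  · unfold cellGap
    rw [e]
    exact nextGap_le (hsub j hj)
  · obtain ⟨k, hk, e'⟩ := exists_nextGap_eq ⟨j, hsub j hj⟩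
    unfold cellGap
    rw [e']
    by_cases ha : Agree m' (x i) (x k)
    · have hk' := mem_cellRight.1 hk
      exact nextGap_le (mem_rightIndices.2 ⟨hk'.1, hk'.2.1, ha⟩)
    · have h1 := point_lt_of_not_agree (mem_cellRight.1 hj).2.2 ha (mem_cellRight.1 hk).2.1
      linarith

lemma gapSum_succ_le_gapSum {α : ℝ} (hα : 0 < α) (s : ℕ → Bool) (m : ℕ)
    (x : Fin n → ℕ → Bool) : gapSum α s (m + 1) x ≤ gapSum α s m x := by
  refine Finset.sum_le_sum fun i _ => ?_
  by_cases h : (cellRight s (m + 1) x i).Nonempty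
  · rw [cellGap_eq_of_nonempty (Nat.le_succ m) h]
  · have : cellGap s (m + 1) x i = 0 := nextGap_eq_zero h
    rw [this, Real.zero_rpow hα.ne']
    exact Real.rpow_nonneg (cellGap_nonneg s m x i) α

/-- Only the last sample of each of the $2^{m+1}$ finer cells can gain a gap, of length at most
$3^{-m}$. -/
lemma gapSum_le_gapSum_succ_add {α : ℝ} (hα : 0 < α) (s : ℕ → Bool) (m : ℕ)
    (x : Fin n → ℕ → Bool) :
    gapSum α s m x ≤ gapSum α s (m + 1) x + 2 ^ (m + 1) * ((1 / 3) ^ m) ^ α := by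
  classical
  have h1 : ∀ i, cellGap s m x i ^ α ≤ cellGap s (m + 1) x i ^ α +
      if ¬ (cellRight s (m + 1) x i).Nonempty then ((1 / 3) ^ m) ^ α else 0 := fun i => by
    by_cases h : (cellRight s (m + 1) x i).Nonempty
    · rw [cellGap_eq_of_nonempty (Nat.le_succ m) h, if_neg (not_not.2 h), add_zero]
    · have : cellGap s (m + 1) x i = 0 := nextGap_eq_zero h
      rw [this, Real.zero_rpow hα.ne', zero_add, if_pos h]
      exact Real.rpow_le_rpow (cellGap_nonneg s m x i) (cellGap_le s m x i) hα.le
  refine (Finset.sum_le_sum fun i _ => h1 i).trans ?_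
  rw [Finset.sum_add_distrib, ← Finset.sum_filter, Finset.sum_const, nsmul_eq_mul]
  have h2 := card_cellRight_empty_le s (m + 1) x
  have h3 : (0 : ℝ) ≤ ((1 / 3 : ℝ) ^ m) ^ α := by positivity
  have h4 : ((Finset.univ.filter fun i => ¬ (cellRight s (m + 1) x i).Nonempty).card : ℝ) ≤
      2 ^ (m + 1) := by exact_mod_cast h2
  have := mul_le_mul_of_nonneg_right h4 h3
  unfold gapSum
  linarith

/-- The contribution of the gaps between different cells of level `m`. -/
lemma abs_gapSum_zero_sub_le {α : ℝ} (hα : 0 < α) (s : ℕ → Bool) (m : ℕ)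
    (x : Fin n → ℕ → Bool) :
    |gapSum α s 0 x - gapSum α s m x| ≤
      ∑ j ∈ Finset.range m, 2 ^ (j + 1) * ((1 / 3 : ℝ) ^ j) ^ α := by
  have : 0 ≤ gapSum α s 0 x - gapSum α s m x ∧ gapSum α s 0 x - gapSum α s m x ≤
      ∑ j ∈ Finset.range m, 2 ^ (j + 1) * ((1 / 3 : ℝ) ^ j) ^ α := by
    induction m with
    | zero => simp
    | succ m ih =>
      have h1 := gapSum_succ_le_gapSum hα s m x
      have h2 := gapSum_le_gapSum_succ_add hα s m x
      rw [Finset.sum_range_succ]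
      constructor <;> linarith
  rw [abs_of_nonneg this.1]
  exact this.2

/-- Comparison with the middle-thirds Cantor set at scales where `s` is constant. -/
lemma abs_gapSum_sub_le {α : ℝ} (h0 : 0 ≤ α) (h1 : α ≤ 1) {s : ℕ → Bool} {b : Bool} {m k : ℕ}
    (hmk : m ≤ k) (hs : ∀ j, m ≤ j → j ≤ k → s j = b) (x : Fin n → ℕ → Bool) :
    |gapSum α s m x - (if b then 5 / 7 else 1) ^ α * gapSum α cantorSeq m x| ≤
      n * (2 * (1 / 3) ^ k) ^ α := by
  set c : ℝ := if b then 5 / 7 else 1 with hc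
  have hc0 : 0 ≤ c := by rw [hc]; split_ifs <;> norm_num
  have hdiff : ∀ i j, Agree m (x i) (x j) →
      |(point s (x j) - point s (x i)) -
        c * (point cantorSeq (x j) - point cantorSeq (x i))| ≤ 2 * (1 / 3) ^ k :=
    fun i j h => h.symm.abs_sub_scale_le hmk hs
  -- Cells and order depend on the addresses alone, so both gaps are minima over the same set of
  -- indices, of distances that agree up to scaling and the error `hdiff`.
  have hmem : ∀ i, cellRight s m x i = cellRight cantorSeq m x i := fun i => by
    ext j
    simp only [mem_cellRight, point_le_point_iff s cantorSeq]
  have hgap : ∀ i, |cellGap s m x i - c * cellGap cantorSeq m x i| ≤ 2 * (1 / 3) ^ k := by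
    intro i
    by_cases h : (cellRight s m x i).Nonempty
    · obtain ⟨j, hj, e⟩ := exists_nextGap_eq h
      have h' := h
      rw [hmem] at h'
      obtain ⟨j', hj', e'⟩ := exists_nextGap_eq h'
      have f1 : cellGap s m x i ≤ _ := nextGap_le ((hmem i).symm ▸ hj' : j' ∈ cellRight s m x i)
      have f2 : cellGap cantorSeq m x i ≤ _ :=
        nextGap_le (hmem i ▸ hj : j ∈ cellRight cantorSeq m x i)
      have g1 := hdiff i j (mem_cellRight.1 hj).2.2
      have g2 := hdiff i j' (mem_cellRight.1 hj').2.2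
      have f3 := mul_le_mul_of_nonneg_left f2 hc0
      unfold cellGap at *
      rw [e, e'] at *
      rw [abs_le] at *
      constructor <;> linarith
    · have e1 : cellGap s m x i = 0 := nextGap_eq_zero h
      have e2 : cellGap cantorSeq m x i = 0 := nextGap_eq_zero (by rw [hmem] at h; exact h)
      rw [e1, e2]
      simp
  have hterm : ∀ i ∈ (Finset.univ : Finset (Fin n)),
      |cellGap s m x i ^ α - c ^ α * cellGap cantorSeq m x i ^ α| ≤ (2 * (1 / 3) ^ k) ^ α := by
    intro i _
    rw [← Real.mul_rpow hc0 (cellGap_nonneg _ _ _ _)]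
    refine (abs_rpow_sub_rpow_le (cellGap_nonneg _ _ _ _)
      (mul_nonneg hc0 (cellGap_nonneg _ _ _ _)) h0 h1).trans ?_
    exact Real.rpow_le_rpow (abs_nonneg _) (hgap i) h0
  unfold gapSum
  rw [Finset.mul_sum, ← Finset.sum_sub_distrib]
  refine (Finset.abs_sum_le_sum_abs _ _).trans ?_
  simpa using Finset.sum_le_card_nsmul _ _ _ hterm

open Classical in
/-- Samples that are alone in their cells of level `K` are followed by large gaps. -/
lemma le_gapSum_cantorSeq {α : ℝ} (hα : 0 < α) (m K : ℕ) (x : Fin n → ℕ → Bool) :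
    ((1 / 3) ^ K) ^ α * (n - 2 ^ m -
      ∑ i, ∑ j ∈ Finset.univ.erase i, if Agree K (x i) (x j) then 1 else 0) ≤
        gapSum α cantorSeq m x := by
  have hB : (0 : ℝ) ≤ ((1 / 3 : ℝ) ^ K) ^ α := by positivity
  -- The bracket is at most 0 when `i` has no sample to its right in its cell of level `m` or shares
  -- its cell of level `K`. Otherwise it equals 1 and the gap is at least $3^{-K}$. Counting
  -- companions instead of testing for one makes the expectation explicit.
  have hterm : ∀ i, ((1 / 3 : ℝ) ^ K) ^ α *
      (1 - (if ¬ (cellRight cantorSeq m x i).Nonempty then 1 else 0) -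
        ∑ j ∈ Finset.univ.erase i, if Agree K (x i) (x j) then 1 else 0) ≤
          cellGap cantorSeq m x i ^ α := by
    intro i
    have hsum : (0 : ℝ) ≤ ∑ j ∈ Finset.univ.erase i, if Agree K (x i) (x j) then 1 else 0 :=
      Finset.sum_nonneg fun j _ => by split_ifs <;> norm_num
    have hpow := Real.rpow_nonneg (cellGap_nonneg cantorSeq m x i) α
    by_cases hne : (cellRight cantorSeq m x i).Nonempty
    · rw [if_neg (not_not.2 hne), sub_zero]
      by_cases hiso : ∃ j, j ≠ i ∧ Agree K (x i) (x j)
      · obtain ⟨j, hji, ha⟩ := hiso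
        have : (1 : ℝ) ≤ ∑ j ∈ Finset.univ.erase i, if Agree K (x i) (x j) then 1 else 0 := by
          refine le_trans (by rw [if_pos ha]) (Finset.single_le_sum
            (f := fun j => if Agree K (x i) (x j) then (1 : ℝ) else 0)
            (fun j _ => by split_ifs <;> norm_num)
            (Finset.mem_erase.2 ⟨hji, Finset.mem_univ j⟩))
        refine le_trans ?_ hpow
        exact mul_nonpos_of_nonneg_of_nonpos hB (by linarith)
      · push Not at hiso
        have hle : (1 / 3 : ℝ) ^ K ≤ cellGap cantorSeq m x i := by
          refine le_nextGap hne fun j hj => ?_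
          have hj' := mem_cellRight.1 hj
          have := pow_le_abs_sub_cantorSeq (hiso j hj'.1)
          rwa [abs_sub_comm, abs_of_nonneg (sub_nonneg.2 hj'.2.1)] at this
        refine le_trans ?_ (Real.rpow_le_rpow (by positivity) hle hα.le)
        exact mul_le_of_le_one_right hB (by linarith)
    · rw [if_pos hne]
      refine le_trans ?_ hpow
      exact mul_nonpos_of_nonneg_of_nonpos hB (by linarith)
  have h := Finset.sum_le_sum fun i (_ : i ∈ (Finset.univ : Finset (Fin n))) => hterm i
  refine le_trans ?_ h
  rw [← Finset.mul_sum, Finset.sum_sub_distrib, Finset.sum_sub_distrib, ← Finset.sum_filter]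
  refine mul_le_mul_of_nonneg_left ?_ hB
  have h2 : ((Finset.univ.filter fun i => ¬ (cellRight cantorSeq m x i).Nonempty).card : ℝ) ≤
      2 ^ m := by exact_mod_cast card_cellRight_empty_le cantorSeq m x
  simp only [Finset.sum_const, Finset.card_univ, Fintype.card_fin, nsmul_eq_mul, mul_one]
  linarith

end ModifiedCantor

/-! ### Minimum spanning trees on the line -/

section LineMST

variable {n : ℕ} {y : Fin n → ℝ}

/-- The distance from `y i` to the next point on its right, and `0` for the last point. -/
noncomputable def succGap (y : Fin n → ℝ) (i : Fin n) : ℝ := nextGap y (fun _ _ => True) i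

/-- The edge `e` passes from the points up to `y i` to the points to the right of `y i`. -/
def CrossesAt (y : Fin n → ℝ) (e : Sym2 (Fin n)) (i : Fin n) : Prop :=
  ∃ u ∈ e, ∃ v ∈ e, y u ≤ y i ∧ y i < y v

lemma succGap_le {i j : Fin n} (h : y i < y j) : succGap y i ≤ y j - y i :=
  nextGap_le (mem_rightIndices.2 ⟨fun e => h.ne (e ▸ rfl), h.le, trivial⟩)

lemma exists_succGap_eq (hy : Function.Injective y) {i j : Fin n} (h : y i < y j) :
    ∃ k, y i < y k ∧ succGap y i = y k - y i := by
  obtain ⟨k, hk, e⟩ := exists_nextGap_eq (y := y) (R := fun _ _ => True) (i := i)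
    ⟨j, mem_rightIndices.2 ⟨fun e => h.ne (e ▸ rfl), h.le, trivial⟩⟩
  rw [mem_rightIndices] at hk
  exact ⟨k, lt_of_le_of_ne hk.2.1 fun e => hk.1 (hy e).symm, e⟩

lemma succGap_eq_zero (hy : Function.Injective y) {i : Fin n} (h : ∀ j, ¬ y i < y j) :
    succGap y i = 0 := by
  refine nextGap_eq_zero ?_
  rintro ⟨j, hj⟩
  rw [mem_rightIndices] at hj
  exact h j (lt_of_le_of_ne hj.2.1 fun e => hj.1 (hy e).symm)

-- Telescoping, by induction on the number of points from `u` up to but excluding `v`: the leftmost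
-- one is removed.
open Classical in
lemma sub_eq_sum_succGap (hy : Function.Injective y) (v : Fin n) : ∀ (N : ℕ) (u : Fin n),
    (Finset.univ.filter fun i => y u ≤ y i ∧ y i < y v).card = N → y u ≤ y v →
      y v - y u = ∑ i ∈ Finset.univ.filter (fun i => y u ≤ y i ∧ y i < y v), succGap y i := by
  intro N
  induction N with
  | zero =>
    intro u hN huv
    rw [Finset.card_eq_zero] at hN
    rw [hN, Finset.sum_empty]
    by_contra hne
    have hlt : y u < y v := lt_of_le_of_ne huv fun e => hne (by rw [e, sub_self])
    have : u ∈ Finset.univ.filter (fun i => y u ≤ y i ∧ y i < y v) := by simp [hlt]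
    rw [hN] at this
    simp at this
  | succ N ih =>
    intro u hN huv
    have hlt : y u < y v := by
      obtain ⟨i, hi⟩ := Finset.card_pos.1 (hN.symm.subst (motive := (0 < ·)) N.succ_pos)
      simp only [Finset.mem_filter, Finset.mem_univ, true_and] at hi
      exact hi.1.trans_lt hi.2
    obtain ⟨w, hw, e⟩ := exists_succGap_eq hy hlt
    have hwv : y w ≤ y v := by linarith [succGap_le hlt]
    have hset : Finset.univ.filter (fun i => y u ≤ y i ∧ y i < y v) =
        insert u (Finset.univ.filter (fun i => y w ≤ y i ∧ y i < y v)) := by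
      ext i
      simp only [Finset.mem_filter, Finset.mem_univ, true_and, Finset.mem_insert]
      constructor
      · rintro ⟨h1, h2⟩
        rcases h1.eq_or_lt with h | h
        · exact Or.inl (hy h).symm
        · exact Or.inr ⟨by linarith [succGap_le h], h2⟩
      · rintro (rfl | ⟨h1, h2⟩)
        · exact ⟨le_rfl, hlt⟩
        · exact ⟨hw.le.trans h1, h2⟩
    have hu : u ∉ Finset.univ.filter (fun i => y w ≤ y i ∧ y i < y v) := by
      simp only [Finset.mem_filter, Finset.mem_univ, true_and, not_and]
      intro h
      exact absurd h hw.not_ge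
    rw [hset, Finset.card_insert_of_notMem hu] at hN
    rw [hset, Finset.sum_insert hu, ← ih w (by omega) hwv, e]
    ring

lemma crossesAt_mk {u v i : Fin n} (h : y u ≤ y v) :
    CrossesAt y s(u, v) i ↔ y u ≤ y i ∧ y i < y v := by
  constructor
  · rintro ⟨a, ha, b, hb, h1, h2⟩
    rw [Sym2.mem_iff] at ha hb
    rcases ha with rfl | rfl <;> rcases hb with rfl | rfl
    · exact absurd h1 h2.not_ge
    · exact ⟨h1, h2⟩
    · exact absurd (h2.trans_le h) h1.not_gt
    · exact absurd h1 h2.not_ge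
  · rintro ⟨h1, h2⟩
    exact ⟨u, Sym2.mem_mk_left u v, v, Sym2.mem_mk_right u v, h1, h2⟩

lemma exists_mk_le (y : Fin n → ℝ) (e : Sym2 (Fin n)) : ∃ u v, e = s(u, v) ∧ y u ≤ y v := by
  induction e using Sym2.ind with
  | _ u v =>
    rcases le_total (y u) (y v) with h | h
    · exact ⟨u, v, rfl, h⟩
    · exact ⟨v, u, Sym2.eq_swap, h⟩

open Classical in
lemma edgeLength_eq_sum (hy : Function.Injective y) (e : Sym2 (Fin n)) :
    edgeLength y e = ∑ i ∈ Finset.univ.filter (CrossesAt y e), succGap y i := by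
  obtain ⟨u, v, rfl, h⟩ := exists_mk_le y e
  have : edgeLength y s(u, v) = y v - y u := by
    simp only [edgeLength, Sym2.lift_mk]
    rw [dist_comm, Real.dist_eq, abs_of_nonneg (sub_nonneg.2 h)]
  rw [this, sub_eq_sum_succGap hy v _ u rfl h]
  refine Finset.sum_congr ?_ fun _ _ => rfl
  ext i
  simp [crossesAt_mk h]

open Classical in
/-- The edges of `T` that cross at `i`. -/
noncomputable def crossing (y : Fin n → ℝ) (T : SimpleGraph (Fin n)) (i : Fin n) :
    Finset (Sym2 (Fin n)) :=
  T.edgeFinset.filter fun e => CrossesAt y e i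

-- Each edge is the sum of the elementary gaps that it spans; exchanging the sums counts each gap
-- once for every edge across it.
open Classical in
lemma graphWeight_one_eq (hy : Function.Injective y) (T : SimpleGraph (Fin n)) :
    graphWeight 1 y T = ∑ i, (crossing y T i).card * succGap y i := by
  unfold graphWeight crossing
  simp only [Real.rpow_one, edgeLength_eq_sum hy, Finset.sum_filter]
  rw [Finset.sum_comm]
  refine Finset.sum_congr rfl fun i _ => ?_
  rw [← Finset.sum_filter, Finset.sum_const, nsmul_eq_mul]

lemma crossing_nonempty {T : SimpleGraph (Fin n)} (hT : T.Connected) {i j : Fin n}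
    (h : y i < y j) : (crossing y T i).Nonempty := by
  classical
  obtain ⟨p⟩ := hT.preconnected i j
  obtain ⟨d, hd, h1, h2⟩ := p.exists_boundary_dart {u | y u ≤ y i}
    (le_refl (y i)) (not_le.2 h)
  refine ⟨d.edge, ?_⟩
  rw [crossing, Finset.mem_filter, SimpleGraph.mem_edgeFinset]
  refine ⟨d.edge_mem, d.fst, ?_, d.snd, ?_, h1, not_le.1 h2⟩
  · exact Sym2.mem_mk_left _ _
  · exact Sym2.mem_mk_right _ _

lemma crossing_eq_empty (T : SimpleGraph (Fin n)) {i : Fin n} (h : ∀ j, ¬ y i < y j) :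
    crossing y T i = ∅ := by
  classical
  rw [crossing, Finset.filter_eq_empty_iff]
  rintro e - ⟨u, -, v, -, -, hv⟩
  exact h v hv

/-- The graph that joins consecutive points. -/
def consecutiveGraph (y : Fin n → ℝ) : SimpleGraph (Fin n) :=
  SimpleGraph.fromRel fun u v => y u < y v ∧ succGap y u = y v - y u

/-- No point lies strictly between the ends of a consecutive edge, so such an edge across the gap
after `y i` must start at `i`. -/
lemma card_crossing_le_one (hy : Function.Injective y) {T : SimpleGraph (Fin n)}
    (hT : T ≤ consecutiveGraph y) (i : Fin n) : (crossing y T i).card ≤ 1 := by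
  classical
  have key : ∀ e ∈ crossing y T i, ∃ v, e = s(i, v) ∧ y v = y i + succGap y i := by
    intro e he
    rw [crossing, Finset.mem_filter, SimpleGraph.mem_edgeFinset] at he
    obtain ⟨he, hc⟩ := he
    obtain ⟨u, v, rfl, huv⟩ := exists_mk_le y e
    rw [crossesAt_mk huv] at hc
    have hadj := hT ((SimpleGraph.mem_edgeSet T).1 he)
    rw [consecutiveGraph, SimpleGraph.fromRel_adj] at hadj
    rcases hadj.2 with h | h
    · have hui : u = i := by
        by_contra hne
        have hlt : y u < y i := lt_of_le_of_ne hc.1 fun e => hne (hy e)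
        linarith [succGap_le hlt]
      subst hui
      exact ⟨v, rfl, by linarith⟩
    · exact absurd huv h.1.not_ge
  rw [Finset.card_le_one]
  intro e he e' he'
  obtain ⟨v, rfl, hv⟩ := key e he
  obtain ⟨v', rfl, hv'⟩ := key e' he'
  rw [hy (hv.trans hv'.symm)]

lemma exists_forall_le (hn : 0 < n) (y : Fin n → ℝ) : ∃ m, ∀ i, y i ≤ y m := by
  have : Nonempty (Fin n) := ⟨⟨0, hn⟩⟩
  exact Finite.exists_max y

lemma consecutiveGraph_connected (hn : 0 < n) (hy : Function.Injective y) :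
    (consecutiveGraph y).Connected := by
  classical
  obtain ⟨m, hm⟩ := exists_forall_le hn y
  have : ∀ (N : ℕ) (u : Fin n), (Finset.univ.filter fun i => y u < y i).card = N →
      (consecutiveGraph y).Reachable u m := by
    intro N
    induction N using Nat.strong_induction_on with
    | _ N ih =>
      intro u hu
      rcases (hm u).eq_or_lt with h | h
      · rw [hy h]
      · obtain ⟨w, hw, e⟩ := exists_succGap_eq hy h
        have hadj : (consecutiveGraph y).Adj u w := by
          rw [consecutiveGraph, SimpleGraph.fromRel_adj]
          exact ⟨fun e => hw.ne (e ▸ rfl), Or.inl ⟨hw, e⟩⟩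
        refine hadj.reachable.trans (ih _ ?_ w rfl)
        rw [← hu]
        refine Finset.card_lt_card ⟨fun i hi => ?_, fun hsub => ?_⟩
        · simp only [Finset.mem_filter, Finset.mem_univ, true_and] at hi ⊢
          exact hw.trans hi
        · have : w ∈ Finset.univ.filter fun i => y w < y i := hsub (by simp [hw])
          simp at this
  rw [SimpleGraph.connected_iff_exists_forall_reachable]
  exact ⟨m, fun u => (this _ u rfl).symm⟩

lemma exists_isTree_graphWeight_le (hn : 0 < n) (hy : Function.Injective y) :
    ∃ T : SimpleGraph (Fin n), T.IsTree ∧ graphWeight 1 y T ≤ ∑ i, succGap y i := by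
  obtain ⟨T, hT, htree⟩ := (consecutiveGraph_connected hn hy).exists_isTree_le
  refine ⟨T, htree, ?_⟩
  rw [graphWeight_one_eq hy]
  refine Finset.sum_le_sum fun i _ => mul_le_of_le_one_left nextGap_nonneg ?_
  exact_mod_cast card_crossing_le_one hy hT i

-- Connectedness makes every gap crossed at least once, and minimality makes it crossed at most
-- once. A tree has as many edges as there are gaps, and every edge crosses some gap; hence each
-- edge crosses exactly one gap, and its length is that gap. Passing to powers $\alpha$ is then
-- legitimate.
open Classical in
lemma graphWeight_eq_of_isMinSpanningTree (hn : 0 < n) (hy : Function.Injective y) {α : ℝ}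
    (hα : α ≠ 0) {T : SimpleGraph (Fin n)} (hT : IsMinSpanningTree y T) :
    graphWeight α y T = ∑ i, succGap y i ^ α := by
  obtain ⟨T₀, hT₀, hle⟩ := exists_isTree_graphWeight_le hn hy
  have hw := (hT.2 T₀ hT₀).trans hle
  rw [graphWeight_one_eq hy] at hw
  have hge : ∀ i ∈ (Finset.univ : Finset (Fin n)),
      succGap y i ≤ (crossing y T i).card * succGap y i := fun i _ => by
    by_cases h : ∃ j, y i < y j
    · obtain ⟨j, hj⟩ := h
      have : 1 ≤ (crossing y T i).card := Finset.card_pos.2 (crossing_nonempty hT.1.connected hj)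
      exact le_mul_of_one_le_left nextGap_nonneg (by exact_mod_cast this)
    · push Not at h
      rw [succGap_eq_zero hy fun j => (h j).not_gt, mul_zero]
  have heq := (Finset.sum_eq_sum_iff_of_le hge).1 (le_antisymm (Finset.sum_le_sum hge) hw)
  have hcard : ∀ i, (crossing y T i).card = if ∃ j, y i < y j then 1 else 0 := fun i => by
    split_ifs with h
    · obtain ⟨j, hj⟩ := h
      have hpos : 0 < succGap y i := by
        obtain ⟨k, hk, e⟩ := exists_succGap_eq hy hj
        rw [e]
        exact sub_pos.2 hk
      have h1 := heq i (Finset.mem_univ i)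
      have h2 : ((crossing y T i).card : ℝ) = 1 := by
        have : ((crossing y T i).card - 1 : ℝ) * succGap y i = 0 := by linarith
        rcases mul_eq_zero.1 this with h | h
        · linarith
        · exact absurd h hpos.ne'
      exact_mod_cast h2
    · push Not at h
      rw [crossing_eq_empty T fun j => (h j).not_gt, Finset.card_empty]
  have hsum : ∑ e ∈ T.edgeFinset, (Finset.univ.filter (CrossesAt y e)).card =
      ∑ i, (crossing y T i).card := by
    simp only [Finset.card_filter, crossing]
    exact Finset.sum_comm
  have hedges : T.edgeFinset.card + 1 = n := by
    have := hT.1.card_edgeFinset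
    simpa using this
  have hone : ∀ e ∈ T.edgeFinset, 1 ≤ (Finset.univ.filter (CrossesAt y e)).card := by
    intro e he
    rw [SimpleGraph.mem_edgeFinset] at he
    obtain ⟨u, v, rfl, huv⟩ := exists_mk_le y e
    have hne : u ≠ v := ((SimpleGraph.mem_edgeSet T).1 he).ne
    refine Finset.card_pos.2 ⟨u, ?_⟩
    simp only [Finset.mem_filter, Finset.mem_univ, true_and, crossesAt_mk huv]
    exact ⟨le_rfl, lt_of_le_of_ne huv fun e => hne (hy e)⟩
  -- The rightmost point has no gap after it, so there are at most $n-1$ crossings in all, and $n-1$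
  -- edges to share them.
  have htotal : ∑ e ∈ T.edgeFinset, (Finset.univ.filter (CrossesAt y e)).card ≤
      ∑ e ∈ T.edgeFinset, 1 := by
    rw [hsum, Finset.sum_congr rfl fun i _ => hcard i, ← Finset.card_filter]
    obtain ⟨m, hm⟩ := exists_forall_le hn y
    have hlt : (Finset.univ.filter fun i => ∃ j, y i < y j).card <
        (Finset.univ : Finset (Fin n)).card := by
      refine Finset.card_lt_card ⟨Finset.filter_subset _ _, fun hsub => ?_⟩
      have := hsub (Finset.mem_univ m)
      simp only [Finset.mem_filter, Finset.mem_univ, true_and] at this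
      obtain ⟨j, hj⟩ := this
      exact hj.not_ge (hm j)
    rw [Finset.card_univ, Fintype.card_fin] at hlt
    simp only [Finset.sum_const, smul_eq_mul, mul_one]
    omega
  have hexact := (Finset.sum_eq_sum_iff_of_le hone).1
    (le_antisymm (Finset.sum_le_sum hone) htotal)
  have hlen : ∀ e ∈ T.edgeFinset,
      edgeLength y e ^ α = ∑ i ∈ Finset.univ.filter (CrossesAt y e), succGap y i ^ α := by
    intro e he
    obtain ⟨i, hi⟩ := Finset.card_eq_one.1 (hexact e he).symm
    rw [edgeLength_eq_sum hy, hi, Finset.sum_singleton, Finset.sum_singleton]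
  unfold graphWeight
  rw [Finset.sum_congr rfl hlen]
  simp only [Finset.sum_filter]
  rw [Finset.sum_comm]
  refine Finset.sum_congr rfl fun i _ => ?_
  rw [← Finset.sum_filter, Finset.sum_const, nsmul_eq_mul]
  have := hcard i
  rw [crossing] at this
  rw [this]
  split_ifs with h
  · simp
  · push Not at h
    rw [succGap_eq_zero hy fun j => (h j).not_gt, Real.zero_rpow hα]
    simp

/-- The minimum spanning tree on distinct points of the line consists of the edges between
consecutive points. -/
theorem mstWeight_eq_sum_succGap (hn : 0 < n) (hy : Function.Injective y) {α : ℝ} (hα : α ≠ 0) :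
    mstWeight α y = ∑ i, succGap y i ^ α := by
  have hex : ∃ T, IsMinSpanningTree y T := by
    obtain ⟨T₀, hT₀, -⟩ := exists_isTree_graphWeight_le hn hy
    obtain ⟨T, hT, hmin⟩ := Set.exists_min_image {T : SimpleGraph (Fin n) | T.IsTree}
      (graphWeight 1 y) (Set.toFinite _) ⟨T₀, hT₀⟩
    exact ⟨T, hT, hmin⟩
  have : graphWeight α y '' {T | IsMinSpanningTree y T} = {∑ i, succGap y i ^ α} := by
    rw [Set.eq_singleton_iff_nonempty_unique_mem]
    refine ⟨Set.Nonempty.image _ hex, ?_⟩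
    rintro _ ⟨T, hT, rfl⟩
    exact graphWeight_eq_of_isMinSpanningTree hn hy hα hT
  rw [mstWeight, this, csInf_singleton]

end LineMST

/-! ### Variance of functions with bounded differences -/

section Variance

variable {X : Type*} [MeasurableSpace X] {μ : Measure X} [IsProbabilityMeasure μ]

lemma memLp_two_of_bound {f : X → ℝ} (hf : Measurable f) {B : ℝ} (hB : ∀ x, |f x| ≤ B) :
    MemLp f 2 μ :=
  MemLp.of_bound hf.aestronglyMeasurable B (ae_of_all _ hB)

/-- A function whose values differ by at most `c` has variance at most `c ^ 2`. -/
lemma variance_le_sq_of_abs_sub_le {f : X → ℝ} (hf : Measurable f) {c : ℝ}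
    (hc : ∀ x y, |f x - f y| ≤ c) : Var[f; μ] ≤ c ^ 2 := by
  have : Nonempty X := μ.nonempty_of_neZero
  let a := Classical.arbitrary X
  have h1 : Var[f; μ] = Var[fun x => f x - f a; μ] :=
    (variance_sub_const hf.aestronglyMeasurable (f a)).symm
  rw [h1]
  refine (variance_le_expectation_sq (hf.sub_const (f a)).aestronglyMeasurable).trans ?_
  have h2 : ∀ x, (f x - f a) ^ 2 ≤ c ^ 2 := fun x => sq_le_sq' (by linarith [abs_le.1 (hc x a)])
    (abs_le.1 (hc x a)).2
  calc ∫ x, ((fun x => f x - f a) ^ 2) x ∂μ ≤ ∫ _, c ^ 2 ∂μ := by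
        refine integral_mono_of_nonneg (ae_of_all _ fun x => sq_nonneg _) (integrable_const _)
          (ae_of_all _ fun x => h2 x)
    _ = c ^ 2 := by simp

/-- A function of `n` independent variables that changes by at most `c` when one variable is
changed has variance at most `n c ^ 2`. -/
theorem variance_pi_le_of_bounded_differences {B c : ℝ} : ∀ (n : ℕ) (f : (Fin n → X) → ℝ),
    Measurable f → (∀ x, |f x| ≤ B) →
    (∀ x p z, |f x - f (Function.update x p z)| ≤ c) →
      Var[f; Measure.pi fun _ => μ] ≤ n * c ^ 2 := by
  intro n
  induction n with
  | zero =>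
    intro f hf _ _
    have : f = fun _ => f default := funext fun x => congrArg f (Subsingleton.elim _ _)
    refine (variance_le_sq_of_abs_sub_le (c := 0) hf fun x y => ?_).trans (by simp)
    rw [this, sub_self, abs_zero]
  | succ n ih =>
    intro f hf hB hc
    set h : X × (Fin n → X) → ℝ := fun q => f (Fin.cons q.1 q.2) with hh
    have hcons : Measurable fun q : X × (Fin n → X) => (Fin.cons q.1 q.2 : Fin (n + 1) → X) := by
      refine measurable_pi_iff.2 fun i => ?_
      refine Fin.cases ?_ (fun j => ?_) i
      · simpa using measurable_fst
      · simpa using! (measurable_pi_apply j).comp measurable_snd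
    have hhm : Measurable h := hf.comp hcons
    have hhB : ∀ q, |h q| ≤ B := fun q => hB _
    have hmp : MeasurePreserving (fun q : X × (Fin n → X) => (Fin.cons q.1 q.2 : Fin (n + 1) → X))
        (μ.prod (Measure.pi fun _ => μ)) (Measure.pi fun _ => μ) := by
      have := (measurePreserving_piFinSuccAbove (fun _ : Fin (n + 1) => μ) 0).symm
      convert this using 1
      ext q i
      refine Fin.cases ?_ (fun j => ?_) i <;> simp [MeasurableEquiv.piFinSuccAbove]
    have hvar : Var[f; Measure.pi fun _ => μ] = Var[h; μ.prod (Measure.pi fun _ => μ)] := by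
      rw [← hmp.map_eq, variance_map (hf.aemeasurable) hcons.aemeasurable]
      rfl
    set ν : Measure (Fin n → X) := Measure.pi fun _ => μ
    -- The conditional mean given the first variable. The variance is the mean of the conditional
    -- variances, bounded by induction, plus the variance of `ψ`, which varies by at most `c`.
    set ψ : X → ℝ := fun a => ∫ x, h (a, x) ∂ν with hψ
    have hψm : Measurable ψ := hhm.stronglyMeasurable.integral_prod_right.measurable
    have hsec : ∀ a, Measurable fun x => h (a, x) := fun a => hhm.comp measurable_prodMk_left
    have hint : ∀ a, Integrable (fun x => h (a, x)) ν := fun a =>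
      (memLp_two_of_bound (hsec a) fun x => hhB _).integrable (by norm_num)
    have hψB : ∀ a, |ψ a| ≤ B := fun a => by
      have := norm_integral_le_of_norm_le_const (μ := ν) (f := fun x => h (a, x))
        (C := B) (ae_of_all _ fun x => hhB (a, x))
      simpa using this
    have hψc : ∀ a a', |ψ a - ψ a'| ≤ c := fun a a' => by
      rw [hψ]
      simp only
      rw [← integral_sub (hint a) (hint a')]
      have := norm_integral_le_of_norm_le_const (μ := ν) (f := fun x => h (a, x) - h (a', x))
        (C := c) (ae_of_all _ fun x => by
          have := hc (Fin.cons a x) 0 a'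
          rwa [Fin.update_cons_zero] at this)
      simpa using this
    have hsecvar : ∀ a, Var[fun x => h (a, x); ν] ≤ n * c ^ 2 := fun a =>
      ih _ (hsec a) (fun x => hhB _) fun x p z => by
        have := hc (Fin.cons a x) p.succ z
        rwa [← Fin.cons_update] at this
    have hsq : ∀ a, ∫ x, h (a, x) ^ 2 ∂ν ≤ n * c ^ 2 + ψ a ^ 2 := fun a => by
      have h1 := hsecvar a
      rw [variance_eq_sub (memLp_two_of_bound (hsec a) fun x => hhB _)] at h1
      simp only [Pi.pow_apply] at h1
      linarith
    have hψ2 : Integrable (fun a => ψ a ^ 2) μ := (memLp_two_of_bound hψm hψB).integrable_sq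
    have hh2 : Integrable (fun q => h q ^ 2) (μ.prod ν) :=
      (memLp_two_of_bound hhm hhB).integrable_sq
    have hh1 : Integrable h (μ.prod ν) :=
      (memLp_two_of_bound hhm hhB).integrable (by norm_num)
    have hψvar := variance_le_sq_of_abs_sub_le (μ := μ) hψm hψc
    rw [variance_eq_sub (memLp_two_of_bound hψm hψB)] at hψvar
    rw [hvar, variance_eq_sub (memLp_two_of_bound hhm hhB)]
    simp only [Pi.pow_apply] at hψvar ⊢
    rw [integral_prod _ hh2, integral_prod _ hh1]
    have h3 : ∫ a, ∫ x, h (a, x) ^ 2 ∂ν ∂μ ≤ ∫ a, (n * c ^ 2 + ψ a ^ 2) ∂μ :=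
      integral_mono hh2.integral_prod_left ((integrable_const _).add hψ2) hsq
    rw [integral_add (integrable_const _) hψ2] at h3
    simp at h3
    push_cast
    change ∫ a, ∫ x, h (a, x) ^ 2 ∂ν ∂μ - (∫ a, ψ a ∂μ) ^ 2 ≤ _
    linarith

end Variance

namespace ModifiedCantor

/-! ### Samples of addresses -/

lemma pi_coin_agree {n : ℕ} {i j : Fin n} (hij : i ≠ j) (K : ℕ) :
    (Measure.pi fun _ : Fin n => coin) {z | Agree K (z i) (z j)} = (2⁻¹ : ENNReal) ^ K := by
  have hind : iIndepFun (fun (k : Fin n) (z : Fin n → ℕ → Bool) => z k)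
      (Measure.pi fun _ : Fin n => coin) :=
    iIndepFun_pi (X := fun _ => id) fun _ => aemeasurable_id
  have h1 := (indepFun_iff_map_prod_eq_prod_map_map (measurable_pi_apply i).aemeasurable
    (measurable_pi_apply j).aemeasurable).1 (hind.indepFun hij)
  rw [(measurePreserving_eval (fun _ : Fin n => coin) i).map_eq,
    (measurePreserving_eval (fun _ : Fin n => coin) j).map_eq] at h1
  have h2 := Measure.map_apply (μ := Measure.pi fun _ : Fin n => coin)
    (f := fun z : Fin n → ℕ → Bool => (z i, z j)) (by fun_prop) (measurableSet_agree K)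
  rw [h1, Measure.prod_apply (measurableSet_agree K)] at h2
  refine h2.symm.trans ?_
  calc ∫⁻ ω, coin (Prod.mk ω ⁻¹' {p | Agree K p.1 p.2}) ∂coin
      = ∫⁻ _, (2⁻¹ : ENNReal) ^ K ∂coin := lintegral_congr fun ω => coin_agree K ω
    _ = (2⁻¹ : ENNReal) ^ K := by simp

/-- Almost surely the samples are distinct, as the formula for the spanning tree requires. -/
lemma pi_coin_not_injective (n : ℕ) :
    (Measure.pi fun _ : Fin n => coin) {z | ¬ Function.Injective z} = 0 := by
  have hsub : {z : Fin n → ℕ → Bool | ¬ Function.Injective z} ⊆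
      ⋃ i, ⋃ j, ⋃ (_ : i ≠ j), {z | z i = z j} := by
    intro z hz
    simp only [mem_ofPred_eq, Function.Injective] at hz
    push Not at hz
    obtain ⟨i, j, h, hij⟩ := hz
    exact mem_iUnion.2 ⟨i, mem_iUnion.2 ⟨j, mem_iUnion.2 ⟨hij, h⟩⟩⟩
  refine measure_mono_null hsub ?_
  refine measure_iUnion_null fun i => measure_iUnion_null fun j => measure_iUnion_null fun hij => ?_
  have hle : ∀ K : ℕ, (Measure.pi fun _ : Fin n => coin) {z | z i = z j} ≤ (2⁻¹ : ENNReal) ^ K :=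
    fun K => by
      rw [← pi_coin_agree hij K]
      exact measure_mono fun z (hz : z i = z j) k _ => by rw [hz]
  refine le_antisymm (ge_of_tendsto' (ENNReal.tendsto_pow_atTop_nhds_zero_of_lt_one ?_) hle)
    (zero_le)
  simp

lemma gapSum_zero_eq {n : ℕ} (α : ℝ) (s : ℕ → Bool) (z : Fin n → ℕ → Bool) :
    gapSum α s 0 z = ∑ i, succGap (fun i => point s (z i)) i ^ α := by
  refine Finset.sum_congr rfl fun i _ => ?_
  congr 1
  exact nextGap_congr rfl (fun _ _ => rfl) fun j => by simp [Agree]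

/-- Deviation probabilities of the normalized weight in terms of samples of addresses. -/
lemma measure_sampleWeight_le {d α : ℝ} (hα : α ≠ 0) (s : ℕ → Bool) {Ω : Type u}
    [MeasurableSpace Ω] (P : Measure Ω) [IsProbabilityMeasure P] (x : ℕ → Ω → ℝ)
    (hx : IsIIDSample P (naturalMeasure s) x) {n : ℕ} (hn : 0 < n) (ε c : ℝ) :
    P {ω | ε ≤ dist (sampleWeight d α x n ω) c} ≤ (Measure.pi fun _ : Fin n => coin)
      {z | ε ≤ |(n : ℝ) ^ (-((d - α) / d)) * gapSum α s 0 z - c|} := by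
  set N : ℝ := (n : ℝ) ^ (-((d - α) / d)) with hN
  -- Written with `succGap`, this event is visibly measurable, so measurability of `mstWeight` is
  -- not needed.
  set B : Set (Fin n → ℝ) := {y | ¬ Function.Injective y} ∪
    {y | ε ≤ |N * ∑ i, succGap y i ^ α - c|} with hB
  have hBm : MeasurableSet B := by
    refine MeasurableSet.union ?_ ?_
    · have : {y : Fin n → ℝ | ¬ Function.Injective y} =
          ⋃ i, ⋃ j, ⋃ (_ : i ≠ j), {y | y i = y j} := by
        ext y
        simp only [mem_ofPred_eq, Function.Injective, mem_iUnion]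
        push Not
        exact exists_congr fun i => exists_congr fun j => by rw [and_comm, exists_prop]
      rw [this]
      exact MeasurableSet.iUnion fun i => MeasurableSet.iUnion fun j => MeasurableSet.iUnion
        fun _ => measurableSet_eq_fun (measurable_pi_apply i) (measurable_pi_apply j)
    · have hm : Measurable fun y : Fin n → ℝ => ∑ i, succGap y i ^ α :=
        Finset.measurable_fun_sum _ fun i _ => Measurable.pow_const (measurable_nextGap
          (fun i => measurable_pi_apply i) (fun _ _ => MeasurableSet.const _) i) α
      exact measurableSet_le measurable_const
        (continuous_abs.measurable.comp ((hm.const_mul N).sub_const c))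
  have hsub : {ω | ε ≤ dist (sampleWeight d α x n ω) c} ⊆ (fun ω (i : Fin n) => x i ω) ⁻¹' B := by
    intro ω hω
    by_cases hinj : Function.Injective fun i : Fin n => x i ω
    · right
      have hω' : ε ≤ dist (sampleWeight d α x n ω) c := hω
      rwa [sampleWeight, normalizedWeight, mstWeight_eq_sum_succGap hn hinj hα,
        Real.dist_eq] at hω'
    · exact Or.inl hinj
  have hmap : P.map (fun ω (i : Fin n) => x i ω) = Measure.pi fun _ => naturalMeasure s := by
    have hind : iIndepFun (fun (i : Fin n) ω => x i ω) P :=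
      hx.indep.precomp (g := fun i : Fin n => (i : ℕ)) Fin.val_injective
    have h := (iIndepFun_iff_map_fun_eq_pi_map
      fun i : Fin n => (hx.measurable i).aemeasurable (μ := P)).1 hind
    simpa only [hx.law] using h
  have hpi : (Measure.pi fun _ : Fin n => naturalMeasure s) =
      (Measure.pi fun _ : Fin n => coin).map fun z i => point s (z i) :=
    (Measure.pi_map_pi fun _ => (measurable_point s).aemeasurable).symm
  have hxm : Measurable fun ω (i : Fin n) => x i ω :=
    measurable_pi_iff.2 fun i => hx.measurable i
  have hpm : Measurable fun (z : Fin n → ℕ → Bool) (i : Fin n) => point s (z i) :=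
    measurable_pi_iff.2 fun i => (measurable_point s).comp (measurable_pi_apply i)
  refine (measure_mono hsub).trans ?_
  rw [← Measure.map_apply hxm hBm, hmap, hpi, Measure.map_apply hpm hBm, hB, preimage_union]
  refine (measure_union_le _ _).trans ?_
  have h0 : (Measure.pi fun _ : Fin n => coin) ((fun (z : Fin n → ℕ → Bool) (i : Fin n) =>
      point s (z i)) ⁻¹' {y | ¬ Function.Injective y}) = 0 := by
    refine measure_mono_null (fun z hz => ?_) (pi_coin_not_injective n)
    exact fun hinj => hz ((point_injective s).comp hinj)
  rw [h0, zero_add]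
  refine measure_mono fun z hz => ?_
  simp only [mem_preimage, mem_ofPred_eq] at hz ⊢
  rwa [gapSum_zero_eq]

/-! ### Concentration and comparison along powers of `16` -/

/-- The expected normalized sum of the gaps in cells of level `3 t` for `16 ^ t` samples from the
middle-thirds Cantor set. -/
noncomputable def meanWeight (d α : ℝ) (t : ℕ) : ℝ :=
  ((16 ^ t : ℕ) : ℝ) ^ (-((d - α) / d)) *
    ∫ z, gapSum α cantorSeq (3 * t) z ∂(Measure.pi fun _ : Fin (16 ^ t) => coin)

section Asymptotics

variable {d α : ℝ}

lemma one_third_rpow_dim (hd : d = Real.log 2 / Real.log 3) : (1 / 3 : ℝ) ^ d = 1 / 2 := by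
  have h3 : Real.log 3 ≠ 0 := (Real.log_pos (by norm_num)).ne'
  rw [Real.rpow_def_of_pos (by norm_num), hd, one_div, Real.log_inv, neg_mul,
    mul_div_cancel₀ _ h3, ← Real.log_inv, Real.exp_log (by norm_num)]
  norm_num

lemma pow_rpow_eq (α : ℝ) (m : ℕ) : ((1 / 3 : ℝ) ^ m) ^ α = ((1 / 3 : ℝ) ^ α) ^ m := by
  rw [← Real.rpow_natCast, ← Real.rpow_mul (by norm_num), mul_comm, Real.rpow_mul (by norm_num),
    Real.rpow_natCast]

lemma half_lt_rpow (hd : d = Real.log 2 / Real.log 3) (hαd : α < d) :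
    1 / 2 < (1 / 3 : ℝ) ^ α := by
  rw [← one_third_rpow_dim hd]
  exact Real.rpow_lt_rpow_of_exponent_gt (by norm_num) (by norm_num) hαd

lemma dim_pos (hd : d = Real.log 2 / Real.log 3) : 0 < d := by
  rw [hd]
  exact div_pos (Real.log_pos (by norm_num)) (Real.log_pos (by norm_num))

lemma dim_le_one (hd : d = Real.log 2 / Real.log 3) : d ≤ 1 := by
  rw [hd, div_le_one (Real.log_pos (by norm_num))]
  exact Real.log_le_log (by norm_num) (by norm_num)

/-- The normalizing factor in terms of `r = 3 ^ (-α)`. -/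
lemma normalizer_eq (hd : d = Real.log 2 / Real.log 3) (t : ℕ) :
    ((16 ^ t : ℕ) : ℝ) ^ (-((d - α) / d)) = (2 * (1 / 3 : ℝ) ^ α)⁻¹ ^ (4 * t) := by
  have hd0 := (dim_pos hd).ne'
  have h2 : (2 : ℝ) ^ (-((d - α) / d)) = (2 * (1 / 3 : ℝ) ^ α)⁻¹ := by
    have hlog : Real.log 3 = Real.log 2 / d := by
      rw [hd]
      field_simp [(Real.log_pos (show (1 : ℝ) < 2 by norm_num)).ne',
        (Real.log_pos (show (1 : ℝ) < 3 by norm_num)).ne']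
    have h3 : (1 / 3 : ℝ) ^ α = 2 ^ (-(α / d)) := by
      rw [Real.rpow_def_of_pos (by norm_num), Real.rpow_def_of_pos (by norm_num), one_div,
        Real.log_inv, hlog]
      congr 1
      ring
    have h4 : (2 : ℝ) * 2 ^ (-(α / d)) = 2 ^ (1 + -(α / d)) := by
      rw [Real.rpow_add (by norm_num), Real.rpow_one]
    rw [h3, h4, ← Real.rpow_neg (by norm_num)]
    congr 1
    field_simp
    ring
  have h5 : ((16 ^ t : ℕ) : ℝ) = (2 : ℝ) ^ ((4 * t : ℕ) : ℝ) := by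
    rw [Real.rpow_natCast, pow_mul]
    norm_num
  rw [h5, ← Real.rpow_mul (by norm_num), mul_comm, Real.rpow_mul (by norm_num), h2,
    Real.rpow_natCast]

/-- A geometric series of ratio $2\cdot3^{-\alpha}>1$, dominated by its last terms. -/
lemma sum_coarse_le (hr : 1 / 2 < (1 / 3 : ℝ) ^ α) (m : ℕ) :
    ∑ j ∈ Finset.range m, 2 ^ (j + 1) * ((1 / 3 : ℝ) ^ j) ^ α ≤
      2 / (2 * (1 / 3 : ℝ) ^ α - 1) * (2 * (1 / 3 : ℝ) ^ α) ^ m := by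
  set r := (1 / 3 : ℝ) ^ α
  have h1 : ∀ j, (2 : ℝ) ^ (j + 1) * ((1 / 3 : ℝ) ^ j) ^ α = 2 * (2 * r) ^ j := fun j => by
    rw [pow_rpow_eq, mul_pow, pow_succ]
    ring
  simp only [h1]
  have hpos : 0 < 2 * r - 1 := by linarith
  rw [← Finset.mul_sum, geom_sum_eq (by linarith), div_mul_eq_mul_div, mul_div_assoc']
  gcongr
  linarith

/-- The error terms of the comparison between the normalized weight and its mean. -/
noncomputable def errorTerm (α : ℝ) (t : ℕ) : ℝ :=
  2 / (2 * (1 / 3 : ℝ) ^ α - 1) * (2 * (1 / 3 : ℝ) ^ α)⁻¹ ^ t + 2 * ((1 / 3 : ℝ) ^ α) ^ t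

lemma tendsto_errorTerm (hα : 0 < α) (hr : 1 / 2 < (1 / 3 : ℝ) ^ α) :
    Tendsto (errorTerm α) atTop (𝓝 0) := by
  have h1 : Tendsto (fun t : ℕ => (2 * (1 / 3 : ℝ) ^ α)⁻¹ ^ t) atTop (𝓝 0) :=
    tendsto_pow_atTop_nhds_zero_of_lt_one (by positivity) (inv_lt_one_of_one_lt₀ (by linarith))
  have h2 : Tendsto (fun t : ℕ => ((1 / 3 : ℝ) ^ α) ^ t) atTop (𝓝 0) :=
    tendsto_pow_atTop_nhds_zero_of_lt_one (by positivity)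
      (Real.rpow_lt_one (by norm_num) (by norm_num) hα)
  have h3 := (h1.const_mul (2 / (2 * (1 / 3 : ℝ) ^ α - 1))).add (h2.const_mul 2)
  rw [mul_zero, mul_zero, add_zero] at h3
  exact h3

lemma normalizer_mul_coarse_le (hr : 1 / 2 < (1 / 3 : ℝ) ^ α) {m k : ℕ} (hmk : m ≤ k) :
    (2 * (1 / 3 : ℝ) ^ α)⁻¹ ^ k * ∑ j ∈ Finset.range m, 2 ^ (j + 1) * ((1 / 3 : ℝ) ^ j) ^ α ≤
      2 / (2 * (1 / 3 : ℝ) ^ α - 1) * (2 * (1 / 3 : ℝ) ^ α)⁻¹ ^ (k - m) := by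
  have h := sum_coarse_le hr m
  set q := 2 * (1 / 3 : ℝ) ^ α with hq
  have hq0 : 0 < q := by linarith
  refine (mul_le_mul_of_nonneg_left h (by positivity)).trans_eq ?_
  obtain ⟨j, rfl⟩ := Nat.exists_eq_add_of_le hmk
  rw [Nat.add_sub_cancel_left, pow_add, inv_pow, inv_pow]
  field_simp

/-- The normalized weight is close to the rescaled weight of the middle-thirds Cantor set at
scales where `s` is constant. -/
lemma abs_normalized_sub_le (hd : d = Real.log 2 / Real.log 3) (hα : 0 < α) (hαd : α < d)
    {s : ℕ → Bool} {b : Bool} {t : ℕ} (hs : ∀ j, 3 * t ≤ j → j ≤ 5 * t → s j = b)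
    (z : Fin (16 ^ t) → ℕ → Bool) :
    |((16 ^ t : ℕ) : ℝ) ^ (-((d - α) / d)) * gapSum α s 0 z -
      (if b then 5 / 7 else 1) ^ α * (((16 ^ t : ℕ) : ℝ) ^ (-((d - α) / d)) *
        gapSum α cantorSeq (3 * t) z)| ≤ errorTerm α t := by
  have hr := half_lt_rpow hd hαd
  have hα1 : α ≤ 1 := hαd.le.trans (dim_le_one hd)
  have h1 := abs_gapSum_zero_sub_le hα s (3 * t) z
  have h2 := abs_gapSum_sub_le hα.le hα1 (show 3 * t ≤ 5 * t by omega) hs z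
  have h3 := normalizer_mul_coarse_le hr (show 3 * t ≤ 4 * t by omega)
  rw [show 4 * t - 3 * t = t by omega] at h3
  rw [normalizer_eq hd]
  -- The contribution of the fine levels: the factors $2^{4t}$ cancel, and $r^{5t}/r^{4t}=r^t$
  -- remains.
  have h4 : (2 * (1 / 3 : ℝ) ^ α)⁻¹ ^ (4 * t) * (((16 ^ t : ℕ) : ℝ) *
      (2 * (1 / 3 : ℝ) ^ (5 * t)) ^ α) ≤ 2 * ((1 / 3 : ℝ) ^ α) ^ t := by
    rw [Real.mul_rpow (by norm_num) (by positivity), pow_rpow_eq]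
    have h2α : (2 : ℝ) ^ α ≤ 2 := by
      simpa using Real.rpow_le_rpow_of_exponent_le (show (1 : ℝ) ≤ 2 by norm_num) hα1
    set r := (1 / 3 : ℝ) ^ α with hr'
    have hr0 : 0 < r := by linarith
    have e : (2 * r)⁻¹ ^ (4 * t) * (((16 ^ t : ℕ) : ℝ) * (2 ^ α * r ^ (5 * t))) =
        2 ^ α * r ^ t := by
      have : ((16 ^ t : ℕ) : ℝ) = 2 ^ (4 * t) := by rw [pow_mul]; norm_num
      rw [this, inv_pow, mul_pow, show 5 * t = 4 * t + t by ring, pow_add r]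
      field_simp
    rw [e]
    gcongr
  set N := (2 * (1 / 3 : ℝ) ^ α)⁻¹ ^ (4 * t)
  have hN : 0 ≤ N := by positivity
  set c : ℝ := (if b then 5 / 7 else 1) ^ α
  have e : N * gapSum α s 0 z - c * (N * gapSum α cantorSeq (3 * t) z) =
      N * (gapSum α s 0 z - gapSum α s (3 * t) z) +
        N * (gapSum α s (3 * t) z - c * gapSum α cantorSeq (3 * t) z) := by ring
  rw [e]
  refine (abs_add_le _ _).trans ?_
  rw [abs_mul, abs_mul, abs_of_nonneg hN, errorTerm]
  exact add_le_add ((mul_le_mul_of_nonneg_left h1 hN).trans h3)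
    ((mul_le_mul_of_nonneg_left h2 hN).trans h4)

/-- Concentration of the normalized weight about its mean. -/
lemma measure_deviation_le (hd : d = Real.log 2 / Real.log 3) (hα : 0 < α) (hαd : α < d)
    (t : ℕ) {η : ℝ} (hη : 0 < η) :
    (Measure.pi fun _ : Fin (16 ^ t) => coin) {z | η ≤ |((16 ^ t : ℕ) : ℝ) ^ (-((d - α) / d)) *
      gapSum α cantorSeq (3 * t) z - meanWeight d α t|} ≤
        ENNReal.ofReal (16 / η ^ 2 * (1 / 4) ^ t) := by
  have hr := half_lt_rpow hd hαd
  set N := ((16 ^ t : ℕ) : ℝ) ^ (-((d - α) / d)) with hN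
  set μ := Measure.pi fun _ : Fin (16 ^ t) => coin with hμ
  set F : (Fin (16 ^ t) → ℕ → Bool) → ℝ := fun z => gapSum α cantorSeq (3 * t) z with hF
  have hFm : Measurable F := measurable_gapSum α cantorSeq (3 * t)
  have hFB : ∀ z, |F z| ≤ ((16 ^ t : ℕ) : ℝ) * ((1 / 3) ^ (3 * t)) ^ α := fun z => by
    rw [abs_of_nonneg (gapSum_nonneg _ _ _ _)]
    exact gapSum_le hα.le _ _ _
  -- This is where cutting at level `3 * t` pays: the influence of one sample carries the factor
  -- $r^{3t}$, and the normalized variance becomes $16\,(16r^2)^{-t}$, with $16r^2>4$.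
  have hvar : Var[F; μ] ≤ ((16 ^ t : ℕ) : ℝ) * (4 * ((1 / 3) ^ (3 * t)) ^ α) ^ 2 :=
    variance_pi_le_of_bounded_differences _ F hFm hFB
      (abs_gapSum_update_sub_le hα.le cantorSeq (3 * t))
  have hcheb := meas_ge_le_variance_div_sq (μ := μ)
    ((memLp_two_of_bound hFm hFB).const_mul N) hη
  have hmean : ∫ z, N * F z ∂μ = meanWeight d α t := by
    rw [integral_const_mul, meanWeight]
  rw [hmean, variance_const_mul] at hcheb
  refine hcheb.trans (ENNReal.ofReal_le_ofReal ?_)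
  rw [div_mul_eq_mul_div]
  refine div_le_div_of_nonneg_right ?_ (sq_nonneg η)
  refine (mul_le_mul_of_nonneg_left hvar (sq_nonneg N)).trans ?_
  rw [hN, normalizer_eq hd, pow_rpow_eq]
  set r := (1 / 3 : ℝ) ^ α with hr'
  have hr0 : 0 < r := by linarith
  have e : ((2 * r)⁻¹ ^ (4 * t)) ^ 2 * (((16 ^ t : ℕ) : ℝ) * (4 * r ^ (3 * t)) ^ 2) =
      16 * ((16 * r ^ 2)⁻¹) ^ t := by
    have : ((16 ^ t : ℕ) : ℝ) = 16 ^ t := by norm_num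
    have hbase : (16 * r ^ 2)⁻¹ = ((2 * r)⁻¹ ^ 4) ^ 2 * (16 * (r ^ 3) ^ 2) := by
      field_simp
      norm_num
    rw [this, hbase, mul_pow _ _ t, mul_pow _ _ t]
    generalize (2 * r)⁻¹ = w
    ring
  rw [e]
  have h4 : (16 * r ^ 2)⁻¹ ≤ 1 / 4 := by
    rw [inv_le_comm₀ (by positivity) (by norm_num)]
    nlinarith
  gcongr

end Asymptotics

end ModifiedCantor

/-! ### Bounds for the means, and convergence where `s` is constant -/

namespace ModifiedCantor

variable {d α : ℝ}

/-- At level $4t$ each of the $2^{4t}$ gaps is at most $3^{-4t}$, which normalizes to 1. Passing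
from level $3t$ to level $4t$ through level 0 costs two coarse sums, each at most $2/(2r-1)$ after
normalization. -/
lemma meanWeight_le (hd : d = Real.log 2 / Real.log 3) (hα : 0 < α) (hαd : α < d) (t : ℕ) :
    meanWeight d α t ≤ 1 + 2 * (2 / (2 * (1 / 3 : ℝ) ^ α - 1)) := by
  have hr := half_lt_rpow hd hαd
  have hpt : ∀ z : Fin (16 ^ t) → ℕ → Bool, (2 * (1 / 3 : ℝ) ^ α)⁻¹ ^ (4 * t) *
      gapSum α cantorSeq (3 * t) z ≤ 1 + 2 * (2 / (2 * (1 / 3 : ℝ) ^ α - 1)) := by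
    intro z
    have h1 := abs_le.1 (abs_gapSum_zero_sub_le hα cantorSeq (3 * t) z)
    have h2 := abs_le.1 (abs_gapSum_zero_sub_le hα cantorSeq (4 * t) z)
    have h3 := normalizer_mul_coarse_le hr (show 3 * t ≤ 4 * t by omega)
    have h4 := normalizer_mul_coarse_le hr (le_refl (4 * t))
    have h5 := gapSum_le hα.le cantorSeq (4 * t) z
    have hq : ∀ k : ℕ, (2 * (1 / 3 : ℝ) ^ α)⁻¹ ^ k ≤ 1 := fun k =>
      pow_le_one₀ (by positivity) (inv_le_one_of_one_le₀ (by linarith))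
    have hC : 0 < 2 / (2 * (1 / 3 : ℝ) ^ α - 1) := div_pos (by norm_num) (by linarith)
    have h3' := h3.trans (mul_le_of_le_one_right hC.le (hq _))
    have h4' := h4.trans (mul_le_of_le_one_right hC.le (hq _))
    have h6 : (2 * (1 / 3 : ℝ) ^ α)⁻¹ ^ (4 * t) *
        (((16 ^ t : ℕ) : ℝ) * ((1 / 3) ^ (4 * t)) ^ α) = 1 := by
      rw [pow_rpow_eq]
      set r := (1 / 3 : ℝ) ^ α with hr'
      have hr0 : 0 < r := by linarith
      have : ((16 ^ t : ℕ) : ℝ) = 2 ^ (4 * t) := by rw [pow_mul]; norm_num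
      rw [this, inv_pow, mul_pow]
      field_simp
    set N := (2 * (1 / 3 : ℝ) ^ α)⁻¹ ^ (4 * t)
    have hN : 0 ≤ N := by positivity
    have h7 : gapSum α cantorSeq (3 * t) z ≤ ((16 ^ t : ℕ) : ℝ) * ((1 / 3) ^ (4 * t)) ^ α +
        ∑ j ∈ Finset.range (3 * t), 2 ^ (j + 1) * ((1 / 3 : ℝ) ^ j) ^ α +
        ∑ j ∈ Finset.range (4 * t), 2 ^ (j + 1) * ((1 / 3 : ℝ) ^ j) ^ α := by
      linarith [h1.1, h2.2]
    have h8 := mul_le_mul_of_nonneg_left h7 hN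
    rw [mul_add, mul_add, h6] at h8
    linarith
  rw [meanWeight, normalizer_eq hd, ← integral_const_mul]
  calc _ ≤ ∫ _, (1 + 2 * (2 / (2 * (1 / 3 : ℝ) ^ α - 1)))
        ∂(Measure.pi fun _ : Fin (16 ^ t) => coin) := by
        refine integral_mono_of_nonneg (ae_of_all _ fun z => ?_) (integrable_const _)
          (ae_of_all _ hpt)
        exact mul_nonneg (by positivity) (gapSum_nonneg _ _ _ _)
    _ = _ := by simp

open Classical in
lemma integral_agree {n : ℕ} {i j : Fin n} (hij : i ≠ j) (K : ℕ) :
    Integrable (fun z : Fin n → ℕ → Bool => if Agree K (z i) (z j) then (1 : ℝ) else 0)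
      (Measure.pi fun _ => coin) ∧
    ∫ z : Fin n → ℕ → Bool, (if Agree K (z i) (z j) then (1 : ℝ) else 0)
      ∂(Measure.pi fun _ => coin) = (1 / 2) ^ K := by
  have hm : MeasurableSet {z : Fin n → ℕ → Bool | Agree K (z i) (z j)} :=
    measurableSet_preimage (f := fun z : Fin n → ℕ → Bool => (z i, z j)) (by fun_prop)
      (measurableSet_agree K)
  have he : (fun z : Fin n → ℕ → Bool => if Agree K (z i) (z j) then (1 : ℝ) else 0) =
      indicator {z | Agree K (z i) (z j)} 1 := by
    ext z
    simp [indicator_apply]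
  rw [he]
  refine ⟨(integrable_const (1 : ℝ)).indicator hm, ?_⟩
  rw [integral_indicator_one hm, Measure.real, pi_coin_agree hij]
  simp

/-- At level $K=4t+1$ the expected number of ordered pairs of samples sharing a cell is at most $n^2
2^{-K}=n/2$. For $t\ge2$ the $2^{3t}$ cells of level $3t$ cost at most $n/4$ more. In mean at least
$n/4$ gaps of length $3^{-K}$ remain. -/
lemma le_meanWeight (hd : d = Real.log 2 / Real.log 3) (hα : 0 < α) (hαd : α < d) {t : ℕ}
    (ht : 2 ≤ t) : (1 / 3 : ℝ) ^ α / 4 ≤ meanWeight d α t := by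
  classical
  have hr := half_lt_rpow hd hαd
  set n := 16 ^ t with hn
  set μ := Measure.pi fun _ : Fin n => coin with hμ
  set K := 4 * t + 1 with hK
  have hint1 : ∀ i : Fin n, ∀ j ∈ Finset.univ.erase i, Integrable
      (fun z : Fin n → ℕ → Bool => if Agree K (z i) (z j) then (1 : ℝ) else 0) μ :=
    fun i j hj => (integral_agree (Finset.ne_of_mem_erase hj).symm K).1
  have hsum : ∫ z : Fin n → ℕ → Bool, ∑ i, ∑ j ∈ Finset.univ.erase i,
      (if Agree K (z i) (z j) then (1 : ℝ) else 0) ∂μ ≤ n * (n * (1 / 2) ^ K) := by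
    rw [integral_finsetSum _ fun i _ => integrable_finsetSum _ (hint1 i)]
    have h1 : ∀ i ∈ (Finset.univ : Finset (Fin n)), ∫ z : Fin n → ℕ → Bool,
        ∑ j ∈ Finset.univ.erase i, (if Agree K (z i) (z j) then (1 : ℝ) else 0) ∂μ ≤
          n * (1 / 2) ^ K := fun i _ => by
      rw [integral_finsetSum _ (hint1 i), Finset.sum_congr rfl fun j hj =>
        (integral_agree (Finset.ne_of_mem_erase hj).symm K).2, Finset.sum_const, nsmul_eq_mul]
      gcongr
      simp
    have := Finset.sum_le_card_nsmul _ _ _ h1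
    rwa [Finset.card_univ, Fintype.card_fin, nsmul_eq_mul] at this
  have hint2 : Integrable (fun z : Fin n → ℕ → Bool => ∑ i, ∑ j ∈ Finset.univ.erase i,
      (if Agree K (z i) (z j) then (1 : ℝ) else 0)) μ :=
    integrable_finsetSum _ fun i _ => integrable_finsetSum _ (hint1 i)
  have hintF : Integrable (fun z : Fin n → ℕ → Bool => gapSum α cantorSeq (3 * t) z) μ :=
    (memLp_two_of_bound (measurable_gapSum α cantorSeq (3 * t)) fun z => by
      rw [abs_of_nonneg (gapSum_nonneg _ _ _ _)]
      exact gapSum_le hα.le _ _ _).integrable (by norm_num)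
  have hmono := integral_mono (μ := μ) ((((integrable_const ((n : ℝ) - 2 ^ (3 * t))).sub
    hint2).const_mul (((1 / 3 : ℝ) ^ K) ^ α))) hintF
    fun z => le_gapSum_cantorSeq hα (3 * t) K z
  rw [integral_const_mul] at hmono
  simp only [Pi.sub_apply] at hmono
  rw [integral_sub (integrable_const _) hint2] at hmono
  simp only [integral_const, probReal_univ, one_smul] at hmono
  rw [meanWeight, normalizer_eq hd]
  rw [pow_rpow_eq] at hmono
  set r := (1 / 3 : ℝ) ^ α with hr'
  have hr0 : 0 < r := by linarith
  have hnr : (n : ℝ) = 2 ^ (4 * t) := by rw [hn, pow_mul]; norm_num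
  have h1 : (n : ℝ) * (n * (1 / 2) ^ K) = n / 2 := by
    rw [hnr, hK, pow_succ (1 / 2 : ℝ), one_div, inv_pow]
    field_simp
  have h2 : (2 : ℝ) ^ (3 * t) ≤ n / 4 := by
    have : (n : ℝ) = 2 ^ (3 * t) * 2 ^ t := by rw [hnr, ← pow_add]; congr 1; ring
    have h4 : (4 : ℝ) ≤ 2 ^ t := by
      calc (4 : ℝ) = 2 ^ 2 := by norm_num
        _ ≤ 2 ^ t := pow_le_pow_right₀ (by norm_num) ht
    rw [this]
    have : (0 : ℝ) < 2 ^ (3 * t) := by positivity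
    nlinarith
  have h3 : r ^ K * (n / 4) ≤ ∫ z, gapSum α cantorSeq (3 * t) z ∂μ := by
    refine le_trans ?_ hmono
    refine mul_le_mul_of_nonneg_left ?_ (by positivity)
    linarith
  refine le_trans (le_of_eq ?_) (mul_le_mul_of_nonneg_left h3 (by positivity))
  rw [hnr, hK, inv_pow, mul_pow, pow_succ]
  field_simp

/-- Convergence of the normalized weights along powers of `16` at whose scales `s` is constant. -/
lemma weightTendsto_of_constant (hd : d = Real.log 2 / Real.log 3) (hα : 0 < α) (hαd : α < d)
    {s : ℕ → Bool} {b : Bool} {t : ℕ → ℕ} (ht : Tendsto t atTop atTop)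
    (hs : ∀ i j, 3 * t i ≤ j → j ≤ 5 * t i → s j = b) {c : ℝ}
    (hc : Tendsto (fun i => meanWeight d α (t i)) atTop (𝓝 c)) :
    WeightTendsto.{u} d α (naturalMeasure s) (fun i => 16 ^ t i)
      ((if b then 5 / 7 else 1) ^ α * c) := by
  intro Ω _ P _ x hx
  have hr := half_lt_rpow hd hαd
  set C : ℝ := (if b then 5 / 7 else 1) ^ α with hC
  have hC01 : 0 ≤ C ∧ C ≤ 1 := by
    rw [hC]
    rcases b with _ | _
    · simp
    · simp only [if_true]
      exact ⟨by positivity, Real.rpow_le_one (by norm_num) (by norm_num) hα.le⟩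
  rw [tendstoInMeasure_iff_dist]
  intro ε hε
  have herr : Tendsto (fun i => errorTerm α (t i) + |meanWeight d α (t i) - c|) atTop (𝓝 0) := by
    have h1 := (tendsto_errorTerm hα hr).comp ht
    have h2 := (hc.sub_const c).abs
    rw [sub_self, abs_zero] at h2
    simpa using! h1.add h2
  have hbound : Tendsto (fun i => ENNReal.ofReal (16 / (ε / 2) ^ 2 * (1 / 4) ^ t i)) atTop
      (𝓝 0) := by
    have h1 : Tendsto (fun k : ℕ => (1 / 4 : ℝ) ^ k) atTop (𝓝 0) :=
      tendsto_pow_atTop_nhds_zero_of_lt_one (by norm_num) (by norm_num)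
    have h2 := ENNReal.tendsto_ofReal ((h1.comp ht).const_mul (16 / (ε / 2) ^ 2))
    rw [mul_zero, ENNReal.ofReal_zero] at h2
    exact h2
  refine tendsto_of_tendsto_of_tendsto_of_le_of_le' tendsto_const_nhds hbound
    (Eventually.of_forall fun _ => zero_le) ?_
  -- Once the deterministic errors are below $\varepsilon/2$, a deviation of $\varepsilon$ forces
  -- the middle-thirds weight to deviate from its mean by $\varepsilon/2$.
  filter_upwards [herr.eventually_lt_const (half_pos hε)] with i hi
  refine (measure_sampleWeight_le hα.ne' s P x hx (by positivity) ε _).trans ?_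
  refine le_trans (measure_mono fun z hz => ?_)
    (measure_deviation_le hd hα hαd (t i) (half_pos hε))
  simp only [mem_ofPred_eq] at hz ⊢
  have h1 := abs_normalized_sub_le hd hα hαd (hs i) z
  set N := ((16 ^ t i : ℕ) : ℝ) ^ (-((d - α) / d))
  set F := gapSum α cantorSeq (3 * t i) z
  set G := gapSum α s 0 z
  have e : N * G - C * c = (N * G - C * (N * F)) + C * (N * F - meanWeight d α (t i)) +
      C * (meanWeight d α (t i) - c) := by ring
  rw [e] at hz
  have h2 := abs_add_three (N * G - C * (N * F)) (C * (N * F - meanWeight d α (t i)))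
    (C * (meanWeight d α (t i) - c))
  rw [abs_mul, abs_mul, abs_of_nonneg hC01.1] at h2
  have h3 := mul_le_of_le_one_left (abs_nonneg (N * F - meanWeight d α (t i))) hC01.2
  have h4 := mul_le_of_le_one_left (abs_nonneg (meanWeight d α (t i) - c)) hC01.2
  linarith

/-! ### The alternating sequence -/

/-- The sequence that switches after each of the levels `5 τ 0, 5 τ 1, …`. -/
def alternatingSeq (τ : ℕ → ℕ) (k : ℕ) : Bool :=
  decide (Odd ((Finset.range k).filter fun b => 5 * τ b < k).card)

section Alternating

variable {τ : ℕ → ℕ}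

lemma alternatingSeq_eq (hτ : StrictMono τ) {a k : ℕ} (h1 : ∀ b < a, 5 * τ b < k)
    (h2 : k ≤ 5 * τ a) : alternatingSeq τ k = decide (Odd a) := by
  have : (Finset.range k).filter (fun b => 5 * τ b < k) = Finset.range a := by
    ext b
    simp only [Finset.mem_filter, Finset.mem_range]
    constructor
    · rintro ⟨-, h⟩
      exact hτ.lt_iff_lt.1 (by omega)
    · intro h
      -- Since $b\le\tau_b$, restricting to `Finset.range k` loses no switch before level `k`.
      have := hτ.id_le b
      have := h1 b h
      simp only [id] at *
      omega
  rw [alternatingSeq, this, Finset.card_range]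

/-- By `hgap`, all earlier switches happen before the window of index `a` opens. -/
lemma alternatingSeq_eq_of_mem (hτ : StrictMono τ) (hgap : ∀ b, 5 * τ b < 3 * τ (b + 1))
    {a k : ℕ} (h1 : 3 * τ a ≤ k) (h2 : k ≤ 5 * τ a) : alternatingSeq τ k = decide (Odd a) := by
  refine alternatingSeq_eq hτ (fun b hb => ?_) h2
  have := hgap b
  have := hτ.monotone (show b + 1 ≤ a from hb)
  omega

lemma alternatesAcrossScales_alternatingSeq (hτ : StrictMono τ)
    (hgap : ∀ b, 5 * τ b < 3 * τ (b + 1)) : AlternatesAcrossScales (alternatingSeq τ) where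
  start := by simp [alternatingSeq]
  frequently_shrunk := by
    rw [frequently_atTop]
    intro N
    have := hτ.id_le (2 * N + 1)
    simp only [id] at this
    refine ⟨3 * τ (2 * N + 1), by omega, ?_⟩
    rw [alternatingSeq_eq_of_mem hτ hgap le_rfl (by omega)]
    simp
  frequently_unshrunk := by
    rw [frequently_atTop]
    intro N
    have := hτ.id_le (2 * N)
    simp only [id] at this
    refine ⟨3 * τ (2 * N), by omega, ?_⟩
    rw [alternatingSeq_eq_of_mem hτ hgap le_rfl (by omega)]
    simp
  long_blocks := by
    intro R
    filter_upwards [eventually_ge_atTop (5 * R + 5 * τ 0 + 1)] with k hk hne j hj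
    have hex : ∃ a, k ≤ 5 * τ a := ⟨k, by
      have := hτ.id_le k
      simp only [id] at this
      omega⟩
    classical
    have ha := Nat.find_spec hex
    have hmin : ∀ b < Nat.find hex, 5 * τ b < k := fun b hb => not_le.1 (Nat.find_min hex hb)
    set a := Nat.find hex
    have hk1 := alternatingSeq_eq hτ hmin ha
    -- A switch occurs only on leaving a level $5\tau_a$. By `hgap` the next one comes no earlier
    -- than level $\tfrac53(k+1)$, and `k` exceeds `5 * R`.
    have hka : k = 5 * τ a := by
      by_contra hlt
      refine hne ?_
      rw [hk1, alternatingSeq_eq hτ (fun b hb => (hmin b hb).trans (Nat.lt_succ_self k))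
        (by omega)]
    have hlow : ∀ b < a + 1, 5 * τ b < k + 1 := fun b hb => by
      have := hτ.monotone (Nat.lt_succ_iff.1 hb)
      omega
    have hup : k + 1 + j ≤ 5 * τ (a + 1) := by
      have := hgap a
      omega
    rw [alternatingSeq_eq hτ (fun b hb => (hlow b hb).trans_le (by omega)) hup,
      alternatingSeq_eq hτ hlow (by omega)]

end Alternating

/-- Indices along which a strictly increasing sequence grows geometrically. -/
def sparseIndex (φ : ℕ → ℕ) : ℕ → ℕ
  | 0 => 0
  | b + 1 => 5 * φ (sparseIndex φ b) + 1

/-- A strictly increasing `φ` satisfies $\varphi(i)\ge i$, so the choice of index makes the next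
value exceed five times the previous one. -/
lemma five_mul_lt_sparseIndex {φ : ℕ → ℕ} (hφ : StrictMono φ) (b : ℕ) :
    5 * φ (sparseIndex φ b) < 3 * φ (sparseIndex φ (b + 1)) := by
  have := hφ.id_le (sparseIndex φ (b + 1))
  simp only [id, sparseIndex] at *
  omega

lemma strictMono_sparseIndex {φ : ℕ → ℕ} (hφ : StrictMono φ) : StrictMono (sparseIndex φ) :=
  strictMono_nat_of_lt_succ fun b => by
    have := hφ.id_le (sparseIndex φ b)
    simp only [id, sparseIndex] at *
    omega

lemma not_tendstoInMeasure_of_two_limits {μ : Measure ℝ} {m n : ℕ → ℕ} (hm : StrictMono m)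
    (hn : StrictMono n) {a b : ℝ} (hab : a ≠ b) (ha : WeightTendsto.{u} d α μ m a)
    (hb : WeightTendsto.{u} d α μ n b) : WeightDiverges.{u} d α μ := by
  rintro Ω _ P _ x hx ⟨Y, hY⟩
  have h1 := tendstoInMeasure_ae_unique (ha Ω P x hx) (hY.comp hm.tendsto_atTop)
  have h2 := tendstoInMeasure_ae_unique (hb Ω P x hx) (hY.comp hn.tendsto_atTop)
  obtain ⟨ω, hω⟩ := (h1.and h2).exists
  exact hab (hω.1.trans hω.2.symm)

end ModifiedCantor

/-! ### Choice of the scales and conclusion -/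

open ModifiedCantor in
theorem mainTheorem2 (d α : ℝ) (hd : d = Real.log 2 / Real.log 3) (hα : 0 < α) (hαd : α < d) :
    ∃ (s : ℕ → Bool) (σ : Measure ℝ),
      AlternatesAcrossScales s ∧
      IsNaturalMeasure s σ ∧
      σ.support = modifiedCantorSet s ∧
      σ.support ⊆ Set.Icc 0 1 ∧
      IsAhlforsRegular d σ ∧
      WeightDiverges.{u} d α σ ∧
      ∃ c > 0,
        (∃ κ : Measure ℝ, IsNaturalMeasure cantorSeq κ ∧
          ∃ l : ℕ → ℕ, StrictMono l ∧ WeightTendsto.{u} d α κ l c) ∧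
        (∃ m : ℕ → ℕ, StrictMono m ∧ WeightTendsto.{u} d α σ m c) ∧
        (∃ n : ℕ → ℕ, StrictMono n ∧ WeightTendsto.{u} d α σ n ((5 / 7) ^ α * c)) := by
  have hr := half_lt_rpow hd hαd
  -- Convergence of the means themselves is not known, so `c` is obtained by compactness. The shift
  -- by 2 is for `le_meanWeight`, whose lower bound also makes `c` positive.
  obtain ⟨c, hc, φ, hφ, hlim⟩ := isCompact_Icc.tendsto_subseq
    (x := fun t => meanWeight d α (t + 2)) fun t =>
      ⟨le_meanWeight hd hα hαd (Nat.le_add_left 2 t), meanWeight_le hd hα hαd (t + 2)⟩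
  have hc0 : 0 < c := lt_of_lt_of_le (by positivity) hc.1
  set φ' : ℕ → ℕ := fun i => φ i + 2 with hφ'
  have hφ'm : StrictMono φ' := fun i j h => Nat.add_lt_add_right (hφ h) 2
  have hlim' : Tendsto (fun i => meanWeight d α (φ' i)) atTop (𝓝 c) := hlim
  set τ : ℕ → ℕ := fun b => φ' (sparseIndex φ' b) with hτ
  have hτm : StrictMono τ := hφ'm.comp (strictMono_sparseIndex hφ'm)
  have hgap : ∀ b, 5 * τ b < 3 * τ (b + 1) := five_mul_lt_sparseIndex hφ'm
  have hτlim : Tendsto (fun b => meanWeight d α (τ b)) atTop (𝓝 c) :=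
    hlim'.comp (strictMono_sparseIndex hφ'm).tendsto_atTop
  have hpow : StrictMono fun k : ℕ => 16 ^ k := pow_right_strictMono₀ (by norm_num)
  have heven : StrictMono fun i : ℕ => 2 * i := fun i j h => by simp only; omega
  have hodd : StrictMono fun i : ℕ => 2 * i + 1 := fun i j h => by simp only; omega
  set s := alternatingSeq τ with hs
  have h1 : WeightTendsto.{u} d α (naturalMeasure s) (fun i => 16 ^ τ (2 * i)) c := by
    have := weightTendsto_of_constant.{u} hd hα hαd (s := s) (b := false)
      (hτm.comp heven).tendsto_atTop
      (fun i j h h' => by rw [hs, alternatingSeq_eq_of_mem hτm hgap h h']; simp)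
      (hτlim.comp heven.tendsto_atTop)
    simpa using! this
  have h2 : WeightTendsto.{u} d α (naturalMeasure s) (fun i => 16 ^ τ (2 * i + 1))
      ((5 / 7) ^ α * c) := by
    have := weightTendsto_of_constant.{u} hd hα hαd (s := s) (b := true)
      (hτm.comp hodd).tendsto_atTop
      (fun i j h h' => by rw [hs, alternatingSeq_eq_of_mem hτm hgap h h']; simp)
      (hτlim.comp hodd.tendsto_atTop)
    simpa using! this
  have h3 : WeightTendsto.{u} d α (naturalMeasure cantorSeq) (fun i => 16 ^ φ' i) c := by
    have := weightTendsto_of_constant.{u} hd hα hαd (s := cantorSeq) (b := false)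
      hφ'm.tendsto_atTop (fun _ _ _ _ => rfl) hlim'
    simpa using this
  have hne : c ≠ (5 / 7) ^ α * c := by
    have : (5 / 7 : ℝ) ^ α < 1 := Real.rpow_lt_one (by norm_num) (by norm_num) hα
    nlinarith
  have hm1 : StrictMono fun i => 16 ^ τ (2 * i) := hpow.comp (hτm.comp heven)
  have hm2 : StrictMono fun i => 16 ^ τ (2 * i + 1) := hpow.comp (hτm.comp hodd)
  refine ⟨s, naturalMeasure s, alternatesAcrossScales_alternatingSeq hτm hgap,
    isNaturalMeasure_naturalMeasure s, ?_, ?_,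
    isAhlforsRegular_naturalMeasure (one_third_rpow_dim hd) (dim_pos hd) s,
    not_tendstoInMeasure_of_two_limits hm1 hm2 hne h1 h2, c, hc0,
    ⟨naturalMeasure cantorSeq, isNaturalMeasure_naturalMeasure _, _, hpow.comp hφ'm, h3⟩,
    ⟨_, hm1, h1⟩, ⟨_, hm2, h2⟩⟩
  · rw [support_naturalMeasure, modifiedCantorSet_eq]
  · rw [support_naturalMeasure]
    exact range_point_subset s
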